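/- Let $R$ be a commutative ring, regarded as a discrete ring. Notation. $\mathsf{TopMod}_R$ is the category of linearly topologized $R$-modules (topological modules in which the open submodules form a basis of neighbourhoods of $0$) and continuous $R$-linear maps, and $\mathsf{TopMod}^{\mathrm{cgwh}}_R$ is its full subcategory of modules whose underlying topological space is compactly generated and weakly Hausdorff. $\mathsf{Tate}_{\aleph_0,R}$ is the category of countable Tate $R$-modules: the idempotent completion of the category of countable elementary Tate objects in the exact category $\mathsf{Proj}^{\mathrm{fg}}_R$ of finitely generated projective $R$-modules. Here a countable admissible Pro-object is a formal limit of a countable codirected diagram in $\mathsf{Proj}^{\mathrm{fg}}_R$ with surjective transition maps, and a countable elementary Tate object is a formal colimit of a diagram $(X_i)_{i\in I}$ of such Pro-objects indexed by a countable directed poset $I$, whose transition maps $X_i\to X_j$ are admissible monics with $X_j/X_i$ in $\mathsf{Proj}^{\mathrm{fg}}_R$. Morphisms of formal colimits and limits are given by the usual formula $\mathrm{Hom}(\text{"colim"}_i X_i,\text{"colim"}_j Y_j)=\lim_i\mathrm{colim}_j\mathrm{Hom}(X_i,Y_j)$ and its dual. The realization functor $\tau\colon\mathsf{Tate}_{\aleph_0,R}\to\mathsf{TopMod}_R$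 is the extension to the idempotent completion of the functor that sends an elementary Tate object to the actual colimit of the actual limits, in $\mathsf{TopMod}_R$, of the corresponding finitely generated projective modules with the discrete topology. $\mathsf{Tate}^{\mathrm{Dr}}_{\aleph_0}(R)$ is the full subcategory of $\mathsf{TopMod}_R$ of direct summands of modules of the form $P\oplus Q^\vee$, where $P$ and $Q$ are discrete, countably generated projective $R$-modules and $Q^\vee$ is the topological linear dual. $R(\!(t)\!)$ carries the $t$-adic topology, with the submodules $t^nR[[t]]$, $n\in\mathbb{Z}$, as a basis of neighbourhoods of $0$. Then: 1. The realization functor $\tau\colon\mathsf{Tate}_{\aleph_0,R}\to\mathsf{TopMod}_R$ is fully faithful and factors through the inclusion $\mathsf{TopMod}^{\mathrm{cgwh}}_R\hookrightarrow\mathsf{TopMod}_R$. Moreover, for every countable Tate $R$-module $T$, the topological module $\tau(T)$ is a direct summand of $R(\!(t)\!)$, and it is metrizable. 2. The inclusion $\mathsf{Tate}^{\mathrm{Dr}}_{\aleph_0}(R)\to\mathsf{TopMod}_R$ factors through $\mathsf{TopMod}^{\mathrm{cgwh}}_R\hookrightarrow\mathsf{TopMod}_R$, i.e. the underlying topological space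 of every object of $\mathsf{Tate}^{\mathrm{Dr}}_{\aleph_0}(R)$ is compactly generated and weakly Hausdorff. Moreover, every object of $\mathsf{Tate}^{\mathrm{Dr}}_{\aleph_0}(R)$ is a direct summand of $R(\!(t)\!)$, and it is metrizable. -/

import Mathlib

open CategoryTheory CategoryTheory.Limits

universe v v' u u'

namespace CountableTate

section IndObjects

/-!
### Countable admissible Ind- and Pro-objects

`W` plays the role of the class of admissible monics of an exact category `C`.
-/

variable {C : Type u} [Category.{v} C] {W : MorphismProperty C}

/-- A countable admissible Ind-diagram in `C`: a functor from a countable (nonempty) directed poset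
all of whose transition maps are admissible.  These are the objects of the category of countable
admissible Ind-objects, whose morphisms are given by the usual formula
`Hom(X, Y) = lim_i colim_j Hom(X_i, Y_j)`.  (Every countable poset has a copy in `Type`.) -/
structure IndObj (C : Type u) [Category.{v} C] (W : MorphismProperty C) where
  /-- The index poset. -/
  I : Type
  [partialOrder : PartialOrder I]
  [isDirected : IsDirectedOrder I]
  [nonempty : Nonempty I]
  [countable : Countable I]
  /-- The diagram. -/
  diag : I ⥤ C
  /-- All transition maps are admissible. -/
  admissible : ∀ {i j : I} (f : i ⟶ j), W (diag.map f)

namespace IndObj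

attribute [instance] partialOrder isDirected nonempty countable

/-- Two maps `A ⟶ Y_j`, `A ⟶ Y_j'` are identified in `colim_j Hom(A, Y_j)` if they become equal at
some later stage. -/
def colimHomSetoid (A : C) (Y : IndObj C W) : Setoid (Σ j : Y.I, A ⟶ Y.diag.obj j) where
  r p q := ∃ (k : Y.I) (hp : p.1 ⟶ k) (hq : q.1 ⟶ k),
    p.2 ≫ Y.diag.map hp = q.2 ≫ Y.diag.map hq
  iseqv :=
    { refl := fun p => ⟨p.1, 𝟙 _, 𝟙 _, rfl⟩
      symm := fun ⟨k, hp, hq, h⟩ => ⟨k, hq, hp, h.symm⟩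
      trans := by
        rintro p q r ⟨k, hp, hq, h⟩ ⟨l, hq', hr, h'⟩
        obtain ⟨m, hkm, hlm⟩ := exists_ge_ge k l
        refine ⟨m, hp ≫ homOfLE hkm, hr ≫ homOfLE hlm, ?_⟩
        have e : hq ≫ homOfLE hkm = hq' ≫ homOfLE hlm := Subsingleton.elim _ _
        rw [Functor.map_comp, ← Category.assoc, h, Category.assoc, ← Functor.map_comp, e,
          Functor.map_comp, ← Category.assoc, h', Category.assoc, ← Functor.map_comp] }

/-- The set `colim_j Hom(A, Y_j)`. -/
def ColimHom (A : C) (Y : IndObj C W) : Type v := Quotient (colimHomSetoid A Y)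

/-- The class of a map `A ⟶ Y_j` in `colim_j Hom(A, Y_j)`. -/
def ColimHom.mk {A : C} {Y : IndObj C W} (j : Y.I) (a : A ⟶ Y.diag.obj j) : ColimHom A Y :=
  Quotient.mk (colimHomSetoid A Y) ⟨j, a⟩

theorem ColimHom.ind {A : C} {Y : IndObj C W} {p : ColimHom A Y → Prop}
    (h : ∀ j a, p (ColimHom.mk j a)) (x : ColimHom A Y) : p x :=
  Quotient.inductionOn x fun y => h y.1 y.2

theorem ColimHom.sound {A : C} {Y : IndObj C W} {j j' k : Y.I} {a : A ⟶ Y.diag.obj j}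
    {a' : A ⟶ Y.diag.obj j'} (f : j ⟶ k) (f' : j' ⟶ k)
    (h : a ≫ Y.diag.map f = a' ≫ Y.diag.map f') : ColimHom.mk j a = ColimHom.mk j' a' :=
  Quotient.sound (s := colimHomSetoid A Y) ⟨k, f, f', h⟩

/-- Precomposition `colim_j Hom(B, Y_j) → colim_j Hom(A, Y_j)` with `a : A ⟶ B`. -/
def ColimHom.precomp {A B : C} {Y : IndObj C W} (a : A ⟶ B) : ColimHom B Y → ColimHom A Y :=
  Quotient.lift (fun p => ColimHom.mk p.1 (a ≫ p.2)) (by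
    rintro p q ⟨k, hp, hq, h⟩
    exact ColimHom.sound hp hq (by simp only [Category.assoc, h]))

@[simp]
theorem ColimHom.precomp_mk {A B : C} {Y : IndObj C W} (a : A ⟶ B) (j : Y.I)
    (b : B ⟶ Y.diag.obj j) : ColimHom.precomp a (ColimHom.mk j b) = ColimHom.mk j (a ≫ b) := rfl

theorem ColimHom.precomp_id {A : C} {Y : IndObj C W} (x : ColimHom A Y) :
    ColimHom.precomp (𝟙 A) x = x := by
  induction x using ColimHom.ind with
  | h j a => simp

theorem ColimHom.precomp_precomp {A B D : C} {Y : IndObj C W} (a : A ⟶ B) (b : B ⟶ D)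
    (x : ColimHom D Y) : ColimHom.precomp a (ColimHom.precomp b x) = ColimHom.precomp (a ≫ b) x := by
  induction x using ColimHom.ind with
  | h j a => simp

/-- A morphism of Ind-objects: an element of `lim_i colim_j Hom(X_i, Y_j)`. -/
@[ext]
structure Hom (X Y : IndObj C W) where
  /-- The components. -/
  val : ∀ i : X.I, ColimHom (X.diag.obj i) Y
  compat : ∀ {i j : X.I} (f : i ⟶ j), ColimHom.precomp (X.diag.map f) (val j) = val i

/-- Postcomposition of an element of `colim_j Hom(A, Y_j)` with a morphism of Ind-objects. -/
def ColimHom.comp {A : C} {Y Z : IndObj C W} (x : ColimHom A Y) (g : Hom Y Z) : ColimHom A Z :=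
  Quotient.lift (fun p : Σ j : Y.I, A ⟶ Y.diag.obj j => ColimHom.precomp p.2 (g.val p.1)) (by
    rintro p q ⟨k, hp, hq, h⟩
    rw [← g.compat hp, ← g.compat hq, ColimHom.precomp_precomp, ColimHom.precomp_precomp, h]) x

@[simp]
theorem ColimHom.mk_comp {A : C} {Y Z : IndObj C W} (j : Y.I) (a : A ⟶ Y.diag.obj j)
    (g : Hom Y Z) : ColimHom.comp (ColimHom.mk j a) g = ColimHom.precomp a (g.val j) := rfl

theorem ColimHom.precomp_comp {A B : C} {Y Z : IndObj C W} (a : A ⟶ B) (x : ColimHom B Y)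
    (g : Hom Y Z) : ColimHom.comp (ColimHom.precomp a x) g = ColimHom.precomp a (x.comp g) := by
  induction x using ColimHom.ind with
  | h j b => simp [ColimHom.precomp_precomp]

instance : Category.{v} (IndObj C W) where
  Hom X Y := Hom X Y
  id X :=
    { val := fun i => ColimHom.mk i (𝟙 _)
      compat := fun {i j} f => ColimHom.sound (𝟙 j) f (by simp) }
  comp f g :=
    { val := fun i => (f.val i).comp g
      compat := fun h => by rw [← ColimHom.precomp_comp, f.compat] }
  id_comp f := Hom.ext (funext fun i => ColimHom.precomp_id _)
  comp_id {X Y} f := Hom.ext (funext fun i => by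
    change ColimHom.comp (f.val i) _ = f.val i
    induction f.val i using ColimHom.ind with
    | h j a => simp)
  assoc f g h := Hom.ext (funext fun i => by
    change ColimHom.comp (ColimHom.comp (f.val i) g) h = ColimHom.comp (f.val i) _
    induction f.val i using ColimHom.ind with
    | h j a => simp [ColimHom.precomp_comp])

/-- The Ind-object given by an object of `C`. -/
def const [W.ContainsIdentities] : C ⥤ IndObj C W where
  obj A :=
    { I := PUnit
      diag := (Functor.const PUnit).obj A
      admissible := fun _ => W.id_mem A }
  map {A B} a :=
    { val := fun i => ColimHom.mk (Y :=
        { I := PUnit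
          diag := (Functor.const PUnit).obj B
          admissible := fun _ => W.id_mem B }) i a
      compat := fun {i j} f => by simp }
  map_id A := rfl
  map_comp {A B D} a b := rfl

noncomputable instance [HasZeroMorphisms C] : HasZeroMorphisms (IndObj C W) where
  zero X Y := ⟨
    { val := fun i => ColimHom.mk (Classical.arbitrary Y.I) 0
      compat := fun f => by simp }⟩
  comp_zero {X Y} f Z := Hom.ext (funext fun i => by
    change ColimHom.comp (f.val i) _ = ColimHom.mk _ 0
    induction f.val i using ColimHom.ind with
    | h j a =>
      change ColimHom.precomp a (ColimHom.mk _ 0) = _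
      simp)
  zero_comp X {Y Z} g := Hom.ext (funext fun i => by
    change ColimHom.precomp 0 (g.val _) = ColimHom.mk _ 0
    induction g.val (Classical.arbitrary Y.I) using ColimHom.ind with
    | h j a =>
      obtain ⟨k, hk, hk'⟩ := exists_ge_ge j (Classical.arbitrary Z.I)
      exact ColimHom.sound (homOfLE hk) (homOfLE hk') (by simp))

variable {D : Type u'} [Category.{v'} D] [HasColimitsOfSize.{0, 0} D]

/-- The map `colim_j Hom(A, Y_j) → Hom(F A, colim_j F Y_j)`. -/
noncomputable def ColimHom.realize (F : C ⥤ D) {A : C} {Y : IndObj C W} (x : ColimHom A Y) :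
    F.obj A ⟶ colimit (Y.diag ⋙ F) :=
  Quotient.lift (fun p : Σ j : Y.I, A ⟶ Y.diag.obj j =>
    F.map p.2 ≫ colimit.ι (Y.diag ⋙ F) p.1) (by
    rintro p q ⟨k, hp, hq, h⟩
    change F.map p.2 ≫ colimit.ι (Y.diag ⋙ F) p.1 = F.map q.2 ≫ colimit.ι (Y.diag ⋙ F) q.1
    rw [← colimit.w (Y.diag ⋙ F) hp, ← colimit.w (Y.diag ⋙ F) hq, Functor.comp_map,
      Functor.comp_map, ← Category.assoc, ← Category.assoc, ← F.map_comp, ← F.map_comp, h]) x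

@[simp]
theorem ColimHom.realize_mk (F : C ⥤ D) {A : C} {Y : IndObj C W} (j : Y.I)
    (a : A ⟶ Y.diag.obj j) :
    (ColimHom.mk j a).realize F = F.map a ≫ colimit.ι (Y.diag ⋙ F) j := rfl

theorem ColimHom.realize_precomp (F : C ⥤ D) {A B : C} {Y : IndObj C W} (a : A ⟶ B)
    (x : ColimHom B Y) : (x.precomp a).realize F = F.map a ≫ x.realize F := by
  induction x using ColimHom.ind with
  | h j b => simp

/-- Realization of formal colimits: the extension of `F : C ⥤ D` to Ind-objects which sends the
formal colimit of a diagram `X` to the actual colimit of `F ∘ X` in `D`. -/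
noncomputable def realize (F : C ⥤ D) : IndObj C W ⥤ D where
  obj X := colimit (X.diag ⋙ F)
  map {X Y} f := colimit.desc (X.diag ⋙ F)
    { pt := colimit (Y.diag ⋙ F)
      ι :=
        { app := fun i => (f.val i).realize F
          naturality := fun i j h => by
            rw [← f.compat h, ColimHom.realize_precomp]
            simp } }
  map_id X := by
    apply colimit.hom_ext
    intro i
    rw [colimit.ι_desc]
    change ColimHom.realize F (ColimHom.mk i (𝟙 _)) = _
    simp
  map_comp {X Y Z} f g := by
    apply colimit.hom_ext
    intro i
    rw [colimit.ι_desc, colimit.ι_desc_assoc]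
    change ColimHom.realize F (ColimHom.comp (f.val i) g) = ColimHom.realize F (f.val i) ≫ _
    induction f.val i using ColimHom.ind with
    | h j a => simp [ColimHom.realize_precomp]

end IndObj

/-- Countable admissible Pro-objects of `C`, for a class `W` of admissible epics: formal limits of
countable codirected diagrams with admissible epic transition maps.  By definition they are
opposite to the Ind-objects of `Cᵒᵖ`, so that `Hom(X, Y) = lim_j colim_i Hom(X_i, Y_j)`. -/
abbrev ProObj (C : Type u) [Category.{v} C] (W : MorphismProperty C) :=
  (IndObj Cᵒᵖ W.op)ᵒᵖ

/-- The constant Pro-object. -/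
abbrev ProObj.const {C : Type u} [Category.{v} C] (W : MorphismProperty C)
    [W.ContainsIdentities] : C ⥤ ProObj C W :=
  (IndObj.const : Cᵒᵖ ⥤ IndObj Cᵒᵖ W.op).rightOp

/-- Realization of formal limits: the extension of `F : C ⥤ D` to Pro-objects which sends the
formal limit of a diagram `X` to the actual limit of `F ∘ X` in `D` (that is, to the colimit of
the opposite diagram in `Dᵒᵖ`). -/
noncomputable abbrev ProObj.realize {C : Type u} [Category.{v} C] {W : MorphismProperty C}
    {D : Type u'} [Category.{v'} D] [HasLimitsOfSize.{0, 0} D] (F : C ⥤ D) : ProObj C W ⥤ D :=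
  (IndObj.realize F.op : IndObj Cᵒᵖ W.op ⥤ Dᵒᵖ).leftOp

end IndObjects

section TateObjects

/-!
### Countable Tate objects in finitely generated projective modules
-/

variable (R : Type u) [CommRing R]

/-- The category of finitely generated projective `R`-modules. -/
abbrev ProjFG := ObjectProperty.FullSubcategory
  (fun M : ModuleCat.{u} R => Module.Finite R M ∧ Module.Projective R M)

/-- Admissible epics of the exact category `ProjFG R` are the surjective maps (their kernels are
automatically finitely generated projective). -/
def admissibleEpi : MorphismProperty (ProjFG R) :=
  fun _ _ f => Function.Surjective f.hom.hom

instance : (admissibleEpi R).ContainsIdentities := ⟨fun _ => Function.surjective_id⟩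

/-- Countable admissible Pro-objects in finitely generated projective modules. -/
abbrev ProFG := ProObj (ProjFG R) (admissibleEpi R)

/-- The morphisms `f : A ⟶ B` of Pro-objects that are admissible monics with `B / A` in
`ProjFG R`.  This means that `f` is part of a short exact sequence `A ⟶ B ⟶ P` with `P` a constant
Pro-object.  The exact structure on Pro-objects is the one induced by the embedding sending `A` to
the left exact functor `U ↦ Hom(A, U)` on `ProjFG R`; since all short exact sequences in `ProjFG R`
split, exactness of a sequence of such functors is tested at each `U` separately, and so the
condition is that `0 → Hom(P, U) → Hom(B, U) → Hom(A, U) → 0` is exact for all `U`. -/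
def elementaryMono : MorphismProperty (ProFG R) := fun A B f =>
  ∃ (P : ProjFG R) (g : B ⟶ (ProObj.const (admissibleEpi R)).obj P), f ≫ g = 0 ∧
    ∀ U : ProjFG R,
      (∀ h : B ⟶ (ProObj.const (admissibleEpi R)).obj U, f ≫ h = 0 →
        ∃! k : P ⟶ U, g ≫ (ProObj.const (admissibleEpi R)).map k = h) ∧
      (∀ a : A ⟶ (ProObj.const (admissibleEpi R)).obj U,
        ∃ h : B ⟶ (ProObj.const (admissibleEpi R)).obj U, f ≫ h = a)

/-- Countable elementary Tate objects: countable admissible Ind-objects in countable admissible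
Pro-objects, presented by a diagram `X` such that `X_j / X_i` is in `ProjFG R` for `i ≤ j`. -/
abbrev TateEl := IndObj (ProFG R) (elementaryMono R)

/-- Countable Tate `R`-modules: the idempotent completion of the category of countable elementary
Tate objects in finitely generated projective `R`-modules. -/
abbrev Tate := Idempotents.Karoubi (TateEl R)

end TateObjects

section TopologicalModules

/-!
### Linearly topologized modules

The ring `R` carries the discrete topology.
-/

variable (R : Type u) [CommRing R] [TopologicalSpace R]

/-- The property of a topological module of being linearly topologized. -/
def isLinear : ObjectProperty (TopModuleCat.{u} R) := fun M => IsLinearTopology R M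

/-- The category of linearly topologized `R`-modules and continuous linear maps. -/
abbrev TopMod := (isLinear R).FullSubcategory

variable {R}

/-- The module `M`, with the linear topology for which the submodules `B i` form a basis of
neighbourhoods of `0`. -/
def ofBasis [DiscreteTopology R] (M : Type u) [AddCommGroup M] [Module R M] {ι : Type u'}
    [Nonempty ι] (B : ι → Submodule R M) (hB : ∀ i j, ∃ k, B k ≤ B i ⊓ B j) : TopMod R :=
  have hB' : SubmodulesBasis B := ⟨hB, fun m i => by simp⟩
  letI : TopologicalSpace M := hB'.topology
  haveI : IsTopologicalAddGroup M :=
    hB'.toModuleFilterBasis.toAddGroupFilterBasis.isTopologicalAddGroup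
  haveI : ContinuousSMul R M := hB'.toModuleFilterBasis.continuousSMul
  { obj := TopModuleCat.of R M
    property := by
      have h := hB'.toModuleFilterBasis.toAddGroupFilterBasis.nhds_zero_hasBasis
      change IsLinearTopology R M
      refine IsLinearTopology.mk_of_hasBasis R (ι := ι) (p := fun _ => True) (s := B) ?_
      refine h.to_hasBasis ?_ ?_
      · rintro _ ⟨i, rfl⟩
        exact ⟨i, trivial, subset_rfl⟩
      · rintro i -
        exact ⟨B i, ⟨i, rfl⟩, subset_rfl⟩ }

theorem ofBasis_hasBasis [DiscreteTopology R] (M : Type u) [AddCommGroup M] [Module R M]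
    {ι : Type u'} [Nonempty ι] (B : ι → Submodule R M) (hB : ∀ i j, ∃ k, B k ≤ B i ⊓ B j) :
    (@nhds M (ofBasis M B hB).obj.topologicalSpace 0).HasBasis (fun _ : ι => True)
      (fun i => (B i : Set M)) := by
  have hB' : SubmodulesBasis B := ⟨hB, fun m i => by simp⟩
  have h := hB'.toModuleFilterBasis.toAddGroupFilterBasis.nhds_zero_hasBasis
  refine h.to_hasBasis ?_ ?_
  · rintro _ ⟨i, rfl⟩
    exact ⟨i, trivial, subset_rfl⟩
  · rintro i -
    exact ⟨B i, ⟨i, rfl⟩, subset_rfl⟩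

/-- A linear map into `ofBasis M B hB` is continuous if the preimages of the `B i` are open. -/
theorem continuous_ofBasis [DiscreteTopology R] (M : Type u) [AddCommGroup M] [Module R M]
    {ι : Type u'} [Nonempty ι] (B : ι → Submodule R M) (hB : ∀ i j, ∃ k, B k ≤ B i ⊓ B j)
    {X : TopModuleCat.{u} R} (f : X →ₗ[R] M) (hf : ∀ i, IsOpen ((B i).comap f : Set X)) :
    @Continuous X M _ (ofBasis M B hB).obj.topologicalSpace f := by
  let _ : TopologicalSpace M := (ofBasis M B hB).obj.topologicalSpace
  have : ContinuousAdd M := (ofBasis M B hB).obj.isTopologicalAddGroup.toContinuousAdd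
  refine continuous_of_tendsto_nhds_zero f ?_
  refine (ofBasis_hasBasis M B hB).tendsto_right_iff.2 fun i _ => ?_
  exact (hf i).mem_nhds (by simp)

theorem isLinear_iff (M : TopModuleCat.{u} R) : isLinear R M ↔
    ∀ s ∈ nhds (0 : M), ∃ N : Submodule R M, (N : Set M) ∈ nhds (0 : M) ∧ (N : Set M) ⊆ s := by
  constructor
  · intro (h : IsLinearTopology R M) s hs
    obtain ⟨N, hN, hNs⟩ := (IsLinearTopology.hasBasis_submodule R).mem_iff.1 hs
    exact ⟨N, hN, hNs⟩
  · intro h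
    refine IsLinearTopology.mk_of_hasBasis R (ι := Submodule R M)
      (p := fun N => (N : Set M) ∈ nhds (0 : M)) (s := fun N => N) ?_
    exact ⟨fun s => ⟨fun hs => h s hs, fun ⟨N, hN, hNs⟩ => Filter.mem_of_superset hN hNs⟩⟩

/-- A linear map from `ofBasis M B hB` to a linearly topologized module is continuous if the
preimage of each open submodule contains some `B i`. -/
theorem continuous_to_linear [DiscreteTopology R] (M : Type u) [AddCommGroup M] [Module R M]
    {ι : Type u'} [Nonempty ι] (B : ι → Submodule R M) (hB : ∀ i j, ∃ k, B k ≤ B i ⊓ B j)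
    (Y : TopMod R) (f : M →ₗ[R] Y.obj)
    (hf : ∀ N : Submodule R Y.obj, IsOpen (N : Set Y.obj) → ∃ i, B i ≤ N.comap f) :
    @Continuous M Y.obj (ofBasis M B hB).obj.topologicalSpace _ f := by
  let _ : TopologicalSpace M := (ofBasis M B hB).obj.topologicalSpace
  have : IsTopologicalAddGroup M := (ofBasis M B hB).obj.isTopologicalAddGroup
  refine continuous_of_tendsto_nhds_zero f ?_
  intro s hs
  have : IsLinearTopology R Y.obj := Y.property
  obtain ⟨N, hN, hNs⟩ := (IsLinearTopology.hasBasis_open_submodule R).mem_iff.1 hs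
  obtain ⟨i, hi⟩ := hf N hN
  exact (ofBasis_hasBasis M B hB).mem_iff.2 ⟨i, trivial, fun x hx => hNs (hi hx)⟩

instance (J : Type) [SmallCategory J] : (isLinear R).IsClosedUnderLimitsOfShape J where
  limitsOfShape_le := by
    rintro M ⟨⟨⟨F, π, hl⟩, hF⟩⟩
    have hc := isLimitOfPreserves (forget₂ (TopModuleCat.{u} R) TopCat) hl
    have ht : M.topologicalSpace = ⨅ j, (F.obj j).topologicalSpace.induced (π.app j) :=
      TopCat.induced_of_isLimit _ hc
    have hn : nhds (0 : M) = ⨅ j, Filter.comap (π.app j) (nhds (0 : F.obj j)) := by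
      have h0 : ∀ j, (π.app j) (0 : M) = 0 := fun j => map_zero (π.app j).hom
      refine (congrArg (fun t => @nhds M t 0) ht).trans ?_
      rw [nhds_iInf]
      refine iInf_congr fun j => ?_
      rw [nhds_induced, h0]
    rw [isLinear_iff]
    intro s hs
    rw [hn] at hs
    refine Filter.iInf_sets_induct hs ?_ ?_
    · exact ⟨⊤, Filter.univ_mem, subset_rfl⟩
    · rintro j s₁ s₂ h₁ ⟨N₂, hN₂, hs₂⟩
      obtain ⟨t, ht, hts⟩ := h₁
      obtain ⟨N₁, hN₁, hs₁⟩ := (isLinear_iff _).1 (hF j) t ht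
      refine ⟨N₁.comap (π.app j).hom.toLinearMap ⊓ N₂, ?_, ?_⟩
      · refine Filter.inter_mem ?_ hN₂
        rw [hn]
        exact Filter.mem_iInf_of_mem j ⟨N₁, hN₁, subset_rfl⟩
      · rintro x ⟨hx₁, hx₂⟩
        exact ⟨hts (hs₁ hx₁), hs₂ hx₂⟩

instance : HasLimitsOfSize.{0, 0} (TopMod R) where
  has_limits_of_shape J _ := by
    have : HasLimitsOfShape J (ModuleCat.{u} R) := ModuleCat.hasLimitsOfShape
    infer_instance

instance : IsIdempotentComplete (TopMod R) := by
  rw [Idempotents.isIdempotentComplete_iff_hasEqualizer_of_id_and_idempotent]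
  intro X p _
  infer_instance

section Colimits

variable [DiscreteTopology R] {J : Type} [SmallCategory J] (F : J ⥤ TopMod R)

/-- The underlying diagram of modules. -/
abbrev moduleDiagram : J ⥤ ModuleCat.{u} R :=
  F ⋙ (isLinear R).ι ⋙ forget₂ (TopModuleCat.{u} R) (ModuleCat.{u} R)

variable (c : Cocone (moduleDiagram F))

/-- The submodules of the colimit whose preimage in each term of the diagram is open. -/
abbrev ColimOpen := { N : Submodule R c.pt // ∀ j, IsOpen (X := (F.obj j).obj)
  ((N.comap (c.ι.app j).hom : Submodule R (F.obj j).obj) : Set (F.obj j).obj) }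

instance : Nonempty (ColimOpen F c) := ⟨⟨⊤, fun _ => isOpen_univ⟩⟩

/-- The colimit of modules, with the finest linear topology for which the maps from the terms
of the diagram are continuous. -/
def colimObj : TopMod R :=
  ofBasis c.pt (fun N : ColimOpen F c => N.1) (fun N N' =>
    ⟨⟨N.1 ⊓ N'.1, fun j => (N.2 j).inter (N'.2 j)⟩, le_rfl⟩)

/-- The colimit cocone in linearly topologized modules. -/
def colimCocone : Cocone F where
  pt := colimObj F c
  ι :=
    { app := fun j => ObjectProperty.homMk (ConcreteCategory.ofHom (C := TopModuleCat R)
        (X := (F.obj j).obj) (Y := (colimObj F c).obj)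
        { toLinearMap := (c.ι.app j).hom
          cont := continuous_ofBasis _ _ _ (X := (F.obj j).obj) (c.ι.app j).hom fun N => N.2 j })
      naturality := fun i j f => by
        ext x
        exact congr($(c.ι.naturality f).hom x) }

/-- The colimit cocone is a colimit if the given cocone of modules is. -/
def colimIsColimit {c : Cocone (moduleDiagram F)} (hc : IsColimit c) :
    IsColimit (colimCocone F c) where
  desc s := ObjectProperty.homMk (ConcreteCategory.ofHom (C := TopModuleCat R)
    (X := (colimObj F c).obj) (Y := s.pt.obj)
    { toLinearMap := (hc.desc
        (((isLinear R).ι ⋙ forget₂ (TopModuleCat.{u} R) (ModuleCat.{u} R)).mapCocone s)).hom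
      cont := by
        refine continuous_to_linear _ _ _ s.pt _ fun N hN => ?_
        refine ⟨⟨N.comap (hc.desc (((isLinear R).ι ⋙
          forget₂ (TopModuleCat.{u} R) (ModuleCat.{u} R)).mapCocone s)).hom, fun j => ?_⟩, le_rfl⟩
        have h := congr(($(hc.fac (((isLinear R).ι ⋙
          forget₂ (TopModuleCat.{u} R) (ModuleCat.{u} R)).mapCocone s) j)).hom)
        rw [ModuleCat.hom_comp] at h
        rw [← Submodule.comap_comp, h]
        exact hN.preimage (s.ι.app j).hom.hom.cont })
  fac s j := by
    ext x
    exact congr($(hc.fac (((isLinear R).ι ⋙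
      forget₂ (TopModuleCat.{u} R) (ModuleCat.{u} R)).mapCocone s) j).hom x)
  uniq s m h := by
    ext x
    refine congr($(hc.uniq (((isLinear R).ι ⋙
      forget₂ (TopModuleCat.{u} R) (ModuleCat.{u} R)).mapCocone s)
      (((isLinear R).ι ⋙ forget₂ (TopModuleCat.{u} R) (ModuleCat.{u} R)).map m)
      fun j => ?_).hom x)
    ext y
    exact congr(($(h j)).hom.hom y)

instance : HasColimitsOfSize.{0, 0} (TopMod R) where
  has_colimits_of_shape _ _ :=
    { has_colimit := fun F =>
        have : HasColimitsOfSize.{0, 0} (ModuleCat.{u} R) :=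
          hasColimitsOfSizeShrink.{0, 0, u, u} (ModuleCat.{u} R)
        ⟨_, colimIsColimit F (colimit.isColimit (moduleDiagram F))⟩ }

end Colimits

/-- `M` is a direct summand of `N` as a topological module. -/
def IsDirectSummand (M N : TopMod R) : Prop :=
  ∃ M' : TopMod R, Nonempty ((M.obj × M'.obj) ≃L[R] N.obj)

variable (R)

/-- Weakly Hausdorff spaces: the continuous image of any compact Hausdorff space is closed. -/
def WeaklyHausdorff (X : Type u) [TopologicalSpace X] : Prop :=
  ∀ (K : CompHaus.{u}) (f : C(K, X)), IsClosed (Set.range f)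

/-- The property of a linearly topologized module that its underlying space is compactly generated
and weakly Hausdorff. -/
def isCGWH : ObjectProperty (TopMod R) := fun M =>
  CompactlyGeneratedSpace M.obj ∧ WeaklyHausdorff M.obj

/-- The category of linearly topologized modules whose underlying topological space is compactly
generated and weakly Hausdorff. -/
abbrev TopModCGWH := (isCGWH R).FullSubcategory

variable [DiscreteTopology R]

/-- The submodule `t ^ n R[[t]]` of `R((t))`. -/
def tPow (n : ℤ) : Submodule R (LaurentSeries R) where
  carrier := {f | ∀ m < n, f.coeff m = 0}
  add_mem' hf hg m hm := by simp [hf m hm, hg m hm]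
  zero_mem' m _ := rfl
  smul_mem' r f hf m hm := by simp [hf m hm]

/-- `R((t))` with the `t`-adic topology, given by the metric `d(f, g) = 2 ^ (-ord(f - g))`. -/
def laurent : TopMod R :=
  ofBasis (LaurentSeries R) (tPow R) fun i j => ⟨max i j, fun _ hf =>
    ⟨fun m hm => hf m (lt_max_of_lt_left hm), fun m hm => hf m (lt_max_of_lt_right hm)⟩⟩

/-- A module is countably generated. -/
def CountablyGenerated (M : Type u) [AddCommGroup M] [Module R M] : Prop :=
  ∃ S : Set M, S.Countable ∧ Submodule.span R S = ⊤

/-- The linearly topologized modules isomorphic to `P ⊕ Qᵛ`, where `P` and `Q` are discrete,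
countably generated projective modules and `Qᵛ` is the topological linear dual: the module of
linear maps from `Q` to the discrete ring `R`, in which the annihilators of finite subsets of `Q`
form a basis of neighbourhoods of `0` (that is, with the weak-* topology). -/
def isTateDrEl : ObjectProperty (TopMod R) := fun M =>
  ∃ (P Q : Type u) (_ : AddCommGroup P) (_ : Module R P) (_ : TopologicalSpace P)
    (_ : DiscreteTopology P) (_ : AddCommGroup Q) (_ : Module R Q) (_ : TopologicalSpace Q)
    (_ : DiscreteTopology Q),
    Module.Projective R P ∧ CountablyGenerated R P ∧
    Module.Projective R Q ∧ CountablyGenerated R Q ∧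
    Nonempty (M.obj ≃L[R] P × WeakDual R Q)

/-- Countable Tate modules in the topological sense: the direct summands, in linearly topologized
modules, of modules of the form `P ⊕ Qᵛ`. -/
def isTateDr : ObjectProperty (TopMod R) := fun M =>
  ∃ N : TopMod R, isTateDrEl R N ∧ IsDirectSummand M N

/-- The category of countable Tate modules in the topological sense. -/
abbrev TateDr := (isTateDr R).FullSubcategory

/-- A module with the discrete topology. -/
def discreteObj (P : Type u) [AddCommGroup P] [Module R P] : TopMod R :=
  letI : TopologicalSpace P := ⊥
  haveI : DiscreteTopology P := ⟨rfl⟩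
  haveI : ContinuousSMul R P := ⟨continuous_of_discreteTopology⟩
  { obj := TopModuleCat.of R P
    property := inferInstanceAs (IsLinearTopology R P) }

/-- Finitely generated projective modules as discrete topological modules. -/
def discrete : ProjFG R ⥤ TopMod R where
  obj P := discreteObj R P.obj
  map {P Q} f := ObjectProperty.homMk (ConcreteCategory.ofHom (C := TopModuleCat R)
    (X := (discreteObj R P.obj).obj) (Y := (discreteObj R Q.obj).obj)
    { toLinearMap := f.hom.hom
      cont := continuous_bot })

/-- The realization of countable elementary Tate objects: a formal colimit of formal limits of
finitely generated projective modules is sent to the actual colimit of the actual limits of these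
modules, with the discrete topology, in linearly topologized modules. -/
noncomputable def realizationEl : TateEl R ⥤ TopMod R :=
  IndObj.realize (ProObj.realize (discrete R))

/-- The realization functor `τ` from countable Tate modules to linearly topologized modules, the
extension of the functor on elementary Tate objects to the idempotent completion. -/
noncomputable def realization : Tate R ⥤ TopMod R :=
  (Idempotents.functorExtension (TateEl R) (TopMod R)).obj (realizationEl R)

end TopologicalModules

end CountableTate

open CountableTate

/-! The second half of both claims rests on one fact: every module in question is a retract of
`R((t))` by continuous linear maps. The kernel of the retraction is then a topological complement,
and a retract embeds, so it inherits metrizability from `R((t))`. Metrizable spaces are compactly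
generated and weakly Hausdorff. As a topological module `R((t))` is `R^ℕ × R^(ℕ)`, with `R^(ℕ)`
discrete; a countably generated projective module is a summand of `R^(ℕ)`, and its dual is a summand
of `R^ℕ`. This settles the modules `P ⊕ Qᵛ`.

For realizations, countability provides cofinal sequences, and all transition maps along them split:
surjections because the modules are projective, elementary monics by `elementaryMono_split`.
Arbitrary maps out of the terms can then be corrected to compatible ones
(`exists_desc_of_isSplitMono`). In the opposite category the same lemma treats limits. It yields
retractions of a limit from `R^(ℕ × ℕ)`, with the product topology, and of a Tate object from its
term `0` plus a countable free discrete module.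

Full faithfulness passes to idempotent completions and may be tested on maps from one term into a
formal colimit. A continuous map from a limit to a discrete module factors through one projection,
since the kernels of the projections form a basis at `0`. A map from a limit to a Tate object lands
in one term: the terms are open, so the kernel of some projection lands in term `0`, and the
quotient by that kernel is finitely generated. -/

namespace CountableTate

/-! ### Functors extended to idempotent completions. -/

section Karoubi

open Idempotents

variable {C : Type u} [Category.{v} C] {D : Type u'} [Category.{v'} D]

instance functorExtension₂_full (F : C ⥤ D) [F.Full] :
    ((functorExtension₂ C D).obj F).Full where
  map_surjective {P Q} g := by
    obtain ⟨f, hf⟩ := F.map_surjective g.f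
    -- The preimage `f` need not be compatible with the idempotents. Sandwiching it between them
    -- repairs this and leaves its image unchanged, by `g.comm`.
    refine ⟨⟨P.p ≫ f ≫ Q.p, by simp⟩, ?_⟩
    ext
    have h := g.comm
    simp only [functorExtension₂_obj_map_f, Functor.map_comp, hf]
    exact h

instance functorExtension₂_faithful (F : C ⥤ D) [F.Faithful] :
    ((functorExtension₂ C D).obj F).Faithful where
  map_injective {P Q f g} h := by
    ext
    exact F.map_injective (congrArg Karoubi.Hom.f h)

variable [IsIdempotentComplete D]

instance functorExtension_full (F : C ⥤ D) [F.Full] :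
    ((functorExtension C D).obj F).Full :=
  inferInstanceAs ((functorExtension₂ C D).obj F ⋙ (toKaroubiEquivalence D).inverse).Full

instance functorExtension_faithful (F : C ⥤ D) [F.Faithful] :
    ((functorExtension C D).obj F).Faithful :=
  inferInstanceAs ((functorExtension₂ C D).obj F ⋙ (toKaroubiEquivalence D).inverse).Faithful

/-- The values of the extension of `F` to the idempotent completion are retracts of values
of `F`. -/
theorem nonempty_retract_functorExtension (F : C ⥤ D) (T : Karoubi C) :
    Nonempty (Retract (((functorExtension C D).obj F).obj T) (F.obj T.X)) :=
  let r := (Karoubi.retract T).map ((functorExtension C D).obj F)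
  let e : ((functorExtension₂ C D).obj F).obj ((toKaroubi C).obj T.X) ≅
      (toKaroubi D).obj (F.obj T.X) :=
    ((functorExtension₂CompWhiskeringLeftToKaroubiIso C D).app F).app T.X
  let e' := (toKaroubiEquivalence D).inverse.mapIso e ≪≫
    (toKaroubiEquivalence D).unitIso.symm.app (F.obj T.X)
  ⟨r.trans (Retract.ofIso e')⟩

end Karoubi

/-! ### Realization of Ind-objects and cofinal sequences. -/

section IndObjects

variable {C : Type u} [Category.{v} C] {W : MorphismProperty C} {D : Type u'} [Category.{v'} D]

namespace IndObj

section

variable [HasColimitsOfSize.{0, 0} D] (F : C ⥤ D)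

/-- A map out of a colimit is a compatible family of maps out of the terms, so one term can be
treated at a time. Injectivity is what makes the chosen preimages compatible. -/
theorem realize_full
    (h : ∀ (X Y : IndObj C W) (i : X.I), Function.Surjective
      (ColimHom.realize F : ColimHom (X.diag.obj i) Y → _))
    (h' : ∀ (X Y : IndObj C W) (i : X.I), Function.Injective
      (ColimHom.realize F : ColimHom (X.diag.obj i) Y → _)) :
    (realize F : IndObj C W ⥤ D).Full where
  map_surjective {X Y} g := by
    choose a ha using fun i => h X Y i (colimit.ι (X.diag ⋙ F) i ≫ g)
    refine ⟨⟨a, fun {i j} f => h' X Y i ?_⟩, ?_⟩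
    · rw [ColimHom.realize_precomp, ha, ha]
      exact (Category.assoc _ _ _).symm.trans (congrArg (· ≫ g) (colimit.w (X.diag ⋙ F) f))
    · apply colimit.hom_ext
      intro i
      exact (colimit.ι_desc _ _).trans (ha i)

theorem realize_faithful
    (h' : ∀ (X Y : IndObj C W) (i : X.I), Function.Injective
      (ColimHom.realize F : ColimHom (X.diag.obj i) Y → _)) :
    (realize F : IndObj C W ⥤ D).Faithful where
  map_injective {X Y f g} h := by
    refine Hom.ext (funext fun i => h' X Y i ?_)
    have e := congrArg (fun k => colimit.ι (X.diag ⋙ F) i ≫ k) h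
    exact (colimit.ι_desc _ _).symm.trans (e.trans (colimit.ι_desc _ _))

end

/-- A cofinal sequence in the index poset of an Ind-object. -/
noncomputable def seq (Y : IndObj C W) : ℕ ⥤ Y.I := IsFiltered.sequentialFunctor Y.I

instance (Y : IndObj C W) : Y.seq.Final :=
  inferInstanceAs (IsFiltered.sequentialFunctor Y.I).Final

theorem exists_le_seq (Y : IndObj C W) (i : Y.I) : ∃ n, i ≤ Y.seq.obj n :=
  IsFiltered.sequentialFunctor_final_aux Y.I i

theorem exists_le_seq_ge (Y : IndObj C W) (i : Y.I) (n : ℕ) :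
    ∃ m, n ≤ m ∧ i ≤ Y.seq.obj m := by
  obtain ⟨m, hm⟩ := Y.exists_le_seq i
  exact ⟨max n m, le_max_left _ _, hm.trans (leOfHom (Y.seq.map (homOfLE (le_max_right n m))))⟩

variable (F : C ⥤ D) (Y : IndObj C W)

/-- The transition maps of the cofinal sequence. -/
noncomputable def stepSeq {m n : ℕ} (h : m ≤ n) :
    F.obj (Y.diag.obj (Y.seq.obj m)) ⟶ F.obj (Y.diag.obj (Y.seq.obj n)) :=
  F.map (Y.diag.map (Y.seq.map (homOfLE h)))

theorem stepSeq_comp {l m n : ℕ} (h : l ≤ m) (h' : m ≤ n) :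
    Y.stepSeq F h ≫ Y.stepSeq F h' = Y.stepSeq F (h.trans h') := by
  simp only [stepSeq, ← Functor.map_comp]
  rfl

theorem stepSeq_refl (n : ℕ) : Y.stepSeq F le_rfl = 𝟙 (F.obj (Y.diag.obj (Y.seq.obj n))) := by
  simp [stepSeq]

variable [HasColimitsOfSize.{0, 0} D]

/-- The map from the `n`-th term of the cofinal sequence to the colimit. -/
noncomputable def ιSeq (n : ℕ) : F.obj (Y.diag.obj (Y.seq.obj n)) ⟶ colimit (Y.diag ⋙ F) :=
  colimit.ι (Y.diag ⋙ F) (Y.seq.obj n)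

theorem stepSeq_ιSeq {m n : ℕ} (h : m ≤ n) : Y.stepSeq F h ≫ Y.ιSeq F n = Y.ιSeq F m :=
  colimit.w (Y.diag ⋙ F) (Y.seq.map (homOfLE h))

theorem exists_ι_eq (i : Y.I) (n : ℕ) : ∃ (m : ℕ) (_ : n ≤ m) (f : i ⟶ Y.seq.obj m),
    F.map (Y.diag.map f) ≫ Y.ιSeq F m = colimit.ι (Y.diag ⋙ F) i := by
  obtain ⟨m, hn, hm⟩ := Y.exists_le_seq_ge i n
  exact ⟨m, hn, homOfLE hm, colimit.w (Y.diag ⋙ F) (homOfLE hm)⟩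

variable {F Y} in
theorem seq_hom_ext {Z : D} {f g : colimit (Y.diag ⋙ F) ⟶ Z}
    (h : ∀ n, Y.ιSeq F n ≫ f = Y.ιSeq F n ≫ g) : f = g := by
  apply colimit.hom_ext
  intro i
  obtain ⟨m, -, a, ha⟩ := Y.exists_ι_eq F i 0
  rw [← ha, Category.assoc, Category.assoc, h]

/-- Compatible maps from the terms of the cofinal sequence induce a map from the colimit. -/
theorem exists_desc {Z : D} (b : ∀ n, F.obj (Y.diag.obj (Y.seq.obj n)) ⟶ Z)
    (hb : ∀ n, Y.stepSeq F n.le_succ ≫ b (n + 1) = b n) :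
    ∃ d : colimit (Y.diag ⋙ F) ⟶ Z, ∀ n, Y.ιSeq F n ≫ d = b n := by
  have hb' : ∀ m n (h : m ≤ n), Y.stepSeq F h ≫ b n = b m := by
    intro m n h
    induction n, h using Nat.le_induction with
    | base => rw [stepSeq_refl, Category.id_comp]
    | succ n h ih => rw [← stepSeq_comp F Y h n.le_succ, Category.assoc, hb, ih]
  let s : Cocone (Y.seq ⋙ Y.diag ⋙ F) :=
    { pt := Z
      ι :=
        { app := b
          naturality := fun m n f => (hb' m n (leOfHom f)).trans (Category.comp_id _).symm } }
  have hc := (Functor.Final.isColimitWhiskerEquiv Y.seq _).symm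
    (colimit.isColimit (Y.diag ⋙ F))
  exact ⟨hc.desc s, fun n => hc.fac s n⟩

variable [Preadditive D]

/-- If the transition maps of the cofinal sequence split, arbitrary maps `b n` from its terms
can be corrected to compatible ones.  After composition with a map `r` for which the `b n` become
compatible, the correction is not visible. -/
theorem exists_desc_of_isSplitMono
    (hs : ∀ n : ℕ, IsSplitMono (Y.stepSeq F n.le_succ)) {Z : D}
    (b : ∀ n, F.obj (Y.diag.obj (Y.seq.obj n)) ⟶ Z) :
    ∃ d : colimit (Y.diag ⋙ F) ⟶ Z, ∀ (Z' : D) (r : Z ⟶ Z') (n : ℕ),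
      (∀ m < n, Y.stepSeq F m.le_succ ≫ b (m + 1) ≫ r = b m ≫ r) →
        Y.ιSeq F n ≫ d ≫ r = b n ≫ r := by
  let ρ (n : ℕ) := retraction (Y.stepSeq F n.le_succ)
  -- Subtracting the restriction of `b (n + 1)` to the previous term and adding `c n`, both extended
  -- by the retraction `ρ n`, gives a map that restricts to `c n`. Where the `b n` agree after `r`,
  -- the two corrections cancel.
  let c : ∀ n, F.obj (Y.diag.obj (Y.seq.obj n)) ⟶ Z := fun n =>
    Nat.rec (b 0) (fun n c => b (n + 1) - ρ n ≫ Y.stepSeq F n.le_succ ≫ b (n + 1) + ρ n ≫ c) n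
  have hc : ∀ n, c (n + 1) =
      b (n + 1) - ρ n ≫ Y.stepSeq F n.le_succ ≫ b (n + 1) + ρ n ≫ c n := fun _ => rfl
  have hρ : ∀ n, Y.stepSeq F n.le_succ ≫ ρ n = 𝟙 _ := fun n => IsSplitMono.id _
  obtain ⟨d, hd⟩ := Y.exists_desc F c fun n => by
    rw [hc, Preadditive.comp_add, Preadditive.comp_sub, reassoc_of% hρ, reassoc_of% hρ]
    simp
  refine ⟨d, fun Z' r n h => ?_⟩
  rw [← Category.assoc, hd]
  induction n with
  | zero => rfl
  | succ n ih =>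
    rw [hc, Preadditive.add_comp, Preadditive.sub_comp, Category.assoc, Category.assoc,
      Category.assoc, ih fun m hm => h m (hm.trans n.lt_succ_self), h n n.lt_succ_self]
    simp

/-- If the transition maps of the cofinal sequence split, the maps from its terms to the
colimit split. -/
theorem isSplitMono_ιSeq (hs : ∀ n : ℕ, IsSplitMono (Y.stepSeq F n.le_succ)) (n : ℕ) :
    IsSplitMono (Y.ιSeq F n) := by
  -- Compatibility is needed only below `n`, so the value `0` beyond `n` does no harm.
  obtain ⟨d, hd⟩ := Y.exists_desc_of_isSplitMono F hs
    (fun m => if h : m ≤ n then Y.stepSeq F h else 0)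
  refine ⟨⟨d, ?_⟩⟩
  have := hd _ (𝟙 _) n fun m hm => by
    simp only [Category.comp_id, dif_pos hm.le, dif_pos (show m + 1 ≤ n from hm), stepSeq_comp]
  simpa [stepSeq_refl] using this

/-- If the transition maps of the cofinal sequence split, and the maps to the colimit lift
along `r : Z ⟶ colim Y`, then the colimit is a retract of `Z`. -/
theorem exists_section_of_isSplitMono (hs : ∀ n : ℕ, IsSplitMono (Y.stepSeq F n.le_succ)) {Z : D}
    (r : Z ⟶ colimit (Y.diag ⋙ F))
    (b : ∀ n, F.obj (Y.diag.obj (Y.seq.obj n)) ⟶ Z) (hb : ∀ n, b n ≫ r = Y.ιSeq F n) :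
    ∃ d : colimit (Y.diag ⋙ F) ⟶ Z, d ≫ r = 𝟙 _ := by
  obtain ⟨d, hd⟩ := Y.exists_desc_of_isSplitMono F hs b
  refine ⟨d, seq_hom_ext fun n => ?_⟩
  rw [hd _ r n fun m _ => by rw [hb, hb, stepSeq_ιSeq], hb, Category.comp_id]

end IndObj

end IndObjects

/-! ### Retracts by continuous linear maps. -/

section TopologicalRetracts

variable (R : Type*) [CommRing R] (M N L : Type*)
  [AddCommMonoid M] [Module R M] [TopologicalSpace M]
  [AddCommMonoid N] [Module R N] [TopologicalSpace N]
  [AddCommMonoid L] [Module R L] [TopologicalSpace L]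

/-- `M` is a retract of `N` by continuous linear maps. -/
def IsTopRetract : Prop :=
  ∃ (s : M →L[R] N) (r : N →L[R] M), ∀ x, r (s x) = x

variable {R M N L}

theorem IsTopRetract.trans (h : IsTopRetract R M N) (h' : IsTopRetract R N L) :
    IsTopRetract R M L := by
  obtain ⟨s, r, h⟩ := h
  obtain ⟨s', r', h'⟩ := h'
  exact ⟨s' ∘L s, r ∘L r', fun x => by simp [h, h']⟩

theorem IsTopRetract.of_equiv (e : M ≃L[R] N) : IsTopRetract R M N :=
  ⟨e, e.symm, fun x => by simp⟩

theorem IsTopRetract.prod {M' N' : Type*} [AddCommMonoid M'] [Module R M'] [TopologicalSpace M']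
    [AddCommMonoid N'] [Module R N'] [TopologicalSpace N']
    (h : IsTopRetract R M N) (h' : IsTopRetract R M' N') :
    IsTopRetract R (M × M') (N × N') := by
  obtain ⟨s, r, h⟩ := h
  obtain ⟨s', r', h'⟩ := h'
  exact ⟨s.prodMap s', r.prodMap r', fun x => Prod.ext (h x.1) (h' x.2)⟩

theorem IsTopRetract.isEmbedding {s : M →L[R] N} {r : N →L[R] M} (h : ∀ x, r (s x) = x) :
    Topology.IsEmbedding s :=
  Topology.IsEmbedding.of_leftInverse h r.continuous s.continuous

theorem IsTopRetract.metrizableSpace (h : IsTopRetract R M N)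
    [TopologicalSpace.MetrizableSpace N] : TopologicalSpace.MetrizableSpace M := by
  obtain ⟨s, r, h⟩ := h
  exact (IsTopRetract.isEmbedding h).metrizableSpace

/-- A linear map to a discrete module is continuous if it vanishes on a neighbourhood of `0`. -/
theorem continuous_of_eventually_eq_zero {M N : Type*} [AddCommGroup M] [Module R M]
    [TopologicalSpace M] [IsTopologicalAddGroup M] [AddCommGroup N] [Module R N]
    [TopologicalSpace N] [DiscreteTopology N] (f : M →ₗ[R] N)
    (h : ∀ᶠ x in nhds (0 : M), f x = 0) : Continuous f := by
  refine continuous_of_tendsto_nhds_zero f ?_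
  rw [nhds_discrete N]
  exact Filter.tendsto_pure.2 h

/-- Extension by zero along an injection `I → J` makes `I → R` a retract of `J → R`. -/
theorem isTopRetract_pi [TopologicalSpace R] {I J : Type*} (f : I → J)
    (hf : Function.Injective f) : IsTopRetract R (I → R) (J → R) := by
  refine ⟨⟨Function.ExtendByZero.linearMap R f, ?_⟩, ⟨LinearMap.funLeft R R f, ?_⟩, fun x => ?_⟩
  · refine continuous_pi fun j => ?_
    by_cases h : ∃ i, f i = j
    · obtain ⟨i, rfl⟩ := h
      simpa [hf.extend_apply] using continuous_apply i
    · simpa [Function.extend_apply' _ _ _ h] using continuous_const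
  · exact continuous_pi fun i => continuous_apply (f i)
  · funext i
    simp [LinearMap.funLeft, hf.extend_apply]

/-- Lets a countable product of copies of `R^ℕ` be absorbed into a single one. -/
theorem isTopRetract_prod_pi [TopologicalSpace R] : IsTopRetract R (ℕ × ℕ → R) (ℕ → R) :=
  isTopRetract_pi (fun x : ℕ × ℕ => Nat.pair x.1 x.2) fun _ _ h => by
    simpa [Prod.ext_iff] using h

end TopologicalRetracts

/-! ### From retracts to direct summands. -/

section Summands

variable {R : Type u} [CommRing R] [TopologicalSpace R]

/-- Submodule neighbourhoods of `0` pull back along `s`. This places kernels of retractions and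
auxiliary products in `TopMod R`. -/
theorem isLinear_of_isInducing {M : TopModuleCat.{u} R} (N : TopMod R) (s : M →L[R] N.obj)
    (hs : Topology.IsInducing s) : isLinear R M := by
  rw [isLinear_iff]
  intro t ht
  rw [hs.nhds_eq_comap, map_zero] at ht
  obtain ⟨U, hU, hUt⟩ := ht
  obtain ⟨K, hK, hKU⟩ := (isLinear_iff _).1 N.property U hU
  refine ⟨K.comap s.toLinearMap, ?_, fun x hx => hUt (hKU hx)⟩
  rw [hs.nhds_eq_comap, map_zero]
  exact ⟨K, hK, subset_rfl⟩

/-- Topological retracts are direct summands. -/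
theorem isDirectSummand_of_isTopRetract {M N : TopMod R} (h : IsTopRetract R M.obj N.obj) :
    IsDirectSummand M N := by
  obtain ⟨s, r, h⟩ := h
  let K : TopMod R := ⟨TopModuleCat.of R (LinearMap.ker r.toLinearMap),
    isLinear_of_isInducing N (Submodule.subtypeL _) Topology.IsInducing.subtypeVal⟩
  -- The inverse of `(x, y) ↦ s x + y` is `z ↦ (r z, z - s (r z))`.
  refine ⟨K, ⟨ContinuousLinearEquiv.equivOfInverse
    (s.coprod (Submodule.subtypeL (LinearMap.ker r.toLinearMap)))
    (r.prod ((ContinuousLinearMap.id R N.obj - s ∘L r).codRestrict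
      (LinearMap.ker r.toLinearMap) fun x => ?_)) ?_ ?_⟩⟩
  · simp [h]
  · rintro ⟨x, y, hy⟩
    have hy' : r y = 0 := hy
    have hr : r (s x + y) = x := by simp [h, hy']
    refine Prod.ext hr (Subtype.ext ?_)
    change s x + y - s (r (s x + y)) = y
    rw [hr, add_sub_cancel_left]
  · intro x
    exact add_sub_cancel (s (r x)) x

theorem IsDirectSummand.isTopRetract {M N : TopMod R} (h : IsDirectSummand M N) :
    IsTopRetract R M.obj N.obj := by
  obtain ⟨M', ⟨e⟩⟩ := h
  exact ⟨e.toContinuousLinearMap ∘L ContinuousLinearMap.inl R M.obj M'.obj,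
    ContinuousLinearMap.fst R M.obj M'.obj ∘L e.symm.toContinuousLinearMap, fun x => by simp⟩

theorem isTopRetract_of_retract {M N : TopMod R} (h : Retract M N) :
    IsTopRetract R M.obj N.obj :=
  ⟨h.i.hom.hom, h.r.hom.hom, fun x => congr($(h.retract).hom.hom x)⟩

theorem isCGWH_of_metrizableSpace (M : TopMod R) [TopologicalSpace.MetrizableSpace M.obj] :
    isCGWH R M :=
  ⟨inferInstance, fun _ f => (isCompact_range f.continuous).isClosed⟩

end Summands

/-! ### Laurent series, and the summands `P ⊕ Qᵛ`. -/

section Laurent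

variable (R : Type u) [CommRing R]

/-- Laurent series split into their regular and their principal part. -/
noncomputable def laurentEquiv : ((ℕ → R) × (ℕ →₀ R)) ≃ₗ[R] LaurentSeries R where
  -- The coefficient at `n ≥ 0` is `x.1 n` and the one at `-(n + 1)` is `x.2 n`; finiteness of the
  -- support of `x.2` bounds the series below.
  toFun x := HahnSeries.ofSuppBddBelow (fun m : ℤ => Int.rec x.1 x.2 m) (by
    obtain ⟨a, v⟩ := x
    refine ⟨Int.negSucc (v.support.sup id), ?_⟩
    rintro (m | m) hm
    · exact (Int.negSucc_lt_zero _).le.trans (Int.natCast_nonneg m)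
    · have : m ∈ v.support := by simpa using hm
      have := Finset.le_sup (f := id) this
      simp only [id] at this
      omega)
  map_add' x y := by
    ext (m | m)
    exacts [rfl, rfl]
  map_smul' c x := by
    ext (m | m)
    exacts [rfl, rfl]
  invFun f :=
    (fun n => f.coeff n,
      -- For `n ≥ -ord f` the exponent `-(n + 1)` lies below `ord f`.
      Finsupp.onFinset (Finset.range (-f.order).toNat) (fun n => f.coeff (Int.negSucc n)) (by
        intro n hn
        rw [Finset.mem_range]
        by_contra h
        exact hn (HahnSeries.coeff_eq_zero_of_lt_order (by omega))))
  left_inv x := by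
    ext n
    exacts [rfl, rfl]
  right_inv f := by
    ext (m | m)
    exacts [rfl, rfl]

variable {R}

theorem laurentEquiv_coeff_natCast (x : (ℕ → R) × (ℕ →₀ R)) (n : ℕ) :
    (laurentEquiv R x).coeff n = x.1 n := rfl

theorem laurentEquiv_coeff_negSucc (x : (ℕ → R) × (ℕ →₀ R)) (n : ℕ) :
    (laurentEquiv R x).coeff (Int.negSucc n) = x.2 n := rfl

theorem exists_section_of_countablyGenerated {P : Type u} [AddCommGroup P] [Module R P]
    [Module.Projective R P] (hP : CountablyGenerated R P) :
    ∃ (s : P →ₗ[R] (ℕ →₀ R)) (r : (ℕ →₀ R) →ₗ[R] P), r ∘ₗ s = LinearMap.id := by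
  obtain ⟨S, hS, hS'⟩ := hP
  -- Adding `0` makes the generating set nonempty, so that `ℕ` enumerates it.
  obtain ⟨e, he⟩ := (hS.insert 0).exists_eq_range (Set.insert_nonempty 0 S)
  have hr : Function.Surjective (Finsupp.linearCombination R e) := by
    rw [← LinearMap.range_eq_top, Finsupp.range_linearCombination, ← he, eq_top_iff, ← hS']
    exact Submodule.span_mono (Set.subset_insert _ _)
  obtain ⟨s, hs⟩ := Module.projective_lifting_property _ (LinearMap.id (R := R) (M := P)) hr
  exact ⟨s, _, hs⟩

theorem countablyGenerated_of_finite (P : Type u) [AddCommGroup P] [Module R P]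
    [h : Module.Finite R P] : CountablyGenerated R P := by
  obtain ⟨S, hS⟩ := h.fg_top
  exact ⟨S, S.countable_toSet, hS⟩

theorem countablyGenerated_finsupp (I : Type) [Countable I] : CountablyGenerated R (I →₀ R) :=
  ⟨Set.range (Finsupp.basisSingleOne (R := R) (ι := I)), Set.countable_range _,
    Finsupp.basisSingleOne.span_eq⟩

variable [TopologicalSpace R] [DiscreteTopology R]

theorem laurent_hasBasis : (nhds (0 : (laurent R).obj)).HasBasis (fun _ : ℤ => True)
    (fun i => (tPow R i : Set (LaurentSeries R))) :=
  ofBasis_hasBasis _ _ _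

/-- The basis at `0` is indexed by `ℤ`, so the uniformity is countably generated; the space is
Hausdorff because a series with nonzero coefficient at `m` lies outside `t^(m+1) R[[t]]`. -/
theorem laurent_metrizableSpace : TopologicalSpace.MetrizableSpace (laurent R).obj := by
  have hc : (nhds (0 : (laurent R).obj)).IsCountablyGenerated :=
    laurent_hasBasis.isCountablyGenerated
  let _ := IsTopologicalAddGroup.rightUniformSpace (laurent R).obj
  have : IsUniformAddGroup (laurent R).obj := isUniformAddGroup_of_addCommGroup
  have : (uniformity (laurent R).obj).IsCountablyGenerated := by
    rw [uniformity_eq_comap_nhds_zero]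
    infer_instance
  have hT : T2Space (laurent R).obj := by
    refine IsTopologicalAddGroup.t2Space_of_zero_sep fun f hf => ?_
    have : ∃ m : ℤ, HahnSeries.coeff (show LaurentSeries R from f) m ≠ 0 := by
      by_contra! h
      exact hf (HahnSeries.ext (funext h))
    obtain ⟨m, hm⟩ := this
    exact ⟨_, laurent_hasBasis.mem_of_mem (i := m + 1) trivial,
      fun h => hm (h m (lt_add_one m))⟩
  exact UniformSpace.metrizableSpace

theorem isTopRetract_laurent {P : Type u} [AddCommGroup P] [Module R P] [TopologicalSpace P]
    [DiscreteTopology P] [Module.Projective R P] (hP : CountablyGenerated R P) :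
    IsTopRetract R ((ℕ → R) × P) (laurent R).obj := by
  obtain ⟨s, r, h⟩ := exists_section_of_countablyGenerated hP
  have hcoeff (n : ℤ) : Continuous (fun f : (laurent R).obj =>
      HahnSeries.coeff (show LaurentSeries R from f) n) := by
    refine continuous_of_eventually_eq_zero
      (M := (laurent R).obj) (R := R) (N := R)
      ⟨⟨fun f => HahnSeries.coeff (show LaurentSeries R from f) n, fun _ _ => rfl⟩,
        fun _ _ => rfl⟩ ?_
    exact laurent_hasBasis.mem_iff.2 ⟨n + 1, trivial, fun f hf => hf n (lt_add_one n)⟩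
  refine ⟨⟨((laurentEquiv R).toLinearMap ∘ₗ LinearMap.prodMap LinearMap.id s :
      ((ℕ → R) × P) →ₗ[R] (laurent R).obj), ?_⟩,
    ⟨(LinearMap.prodMap LinearMap.id r ∘ₗ (laurentEquiv R).symm.toLinearMap :
      (laurent R).obj →ₗ[R] ((ℕ → R) × P)), ?_⟩, ?_⟩
  · refine continuous_of_tendsto_nhds_zero
      (((laurentEquiv R).toLinearMap ∘ₗ LinearMap.prodMap LinearMap.id s :
      ((ℕ → R) × P) →ₗ[R] (laurent R).obj)) ?_
    refine laurent_hasBasis.tendsto_right_iff.2 fun i _ => ?_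
    -- Since `P` is discrete, only the regular part matters near `0`, and lying in `t^i R[[t]]`
    -- constrains just its first `i.toNat` coordinates.
    rw [nhds_prod_eq, nhds_discrete P, Filter.prod_pure, Filter.eventually_map]
    have : ∀ᶠ a : ℕ → R in nhds 0, ∀ n ∈ Finset.range i.toNat, a n = 0 := by
      rw [Filter.eventually_all_finset]
      intro n _
      have := (continuous_apply (A := fun _ : ℕ => R) n).tendsto 0
      rw [nhds_discrete R] at this
      exact Filter.tendsto_pure.1 this
    filter_upwards [this] with a ha
    rintro (m | m) hm
    · refine (laurentEquiv_coeff_natCast _ m).trans (ha m ?_)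
      rw [Finset.mem_range]
      have : (m : ℤ) < i := hm
      omega
    · refine (laurentEquiv_coeff_negSucc _ m).trans ?_
      simp
  · refine Continuous.prodMk (continuous_pi fun n => hcoeff n) ?_
    refine continuous_of_eventually_eq_zero (M := (laurent R).obj)
      (r ∘ₗ LinearMap.snd R _ _ ∘ₗ (laurentEquiv R).symm.toLinearMap) ?_
    -- Principal parts vanish on the open submodule `R[[t]]`.
    refine laurent_hasBasis.mem_iff.2 ⟨0, trivial, fun f hf => ?_⟩
    have : ((laurentEquiv R).symm f).2 = 0 := by
      ext n
      exact hf _ (Int.negSucc_lt_zero n)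
    change r ((laurentEquiv R).symm f).2 = 0
    rw [this, map_zero]
  · intro x
    change LinearMap.prodMap LinearMap.id r ((laurentEquiv R).symm (laurentEquiv R _)) = x
    rw [LinearEquiv.symm_apply_apply]
    exact Prod.ext rfl congr($h x.2)

/-- Dualize the splitting of `Q` off `R^(ℕ)`: the dual of `R^(ℕ)` is `R^ℕ`, with pointwise
convergence on both sides. -/
theorem isTopRetract_weakDual {Q : Type u} [AddCommGroup Q] [Module R Q] [TopologicalSpace Q]
    [DiscreteTopology Q] [Module.Projective R Q] (hQ : CountablyGenerated R Q) :
    IsTopRetract R (WeakDual R Q) (ℕ → R) := by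
  obtain ⟨s, r, h⟩ := exists_section_of_countablyGenerated hQ
  refine ⟨⟨⟨⟨fun φ n => φ (r (Finsupp.single n 1)), fun _ _ => rfl⟩, fun _ _ => rfl⟩, ?_⟩,
    ⟨⟨⟨fun a => StrongDual.toWeakDual
      ⟨Finsupp.linearCombination R a ∘ₗ s, continuous_of_discreteTopology⟩, ?_⟩, ?_⟩, ?_⟩, ?_⟩
  · exact continuous_pi fun n => WeakDual.eval_continuous _
  · intro a b
    refine DFunLike.ext _ _ fun q => ?_
    change Finsupp.linearCombination R (a + b) (s q) =
      Finsupp.linearCombination R a (s q) + Finsupp.linearCombination R b (s q)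
    simp [Finsupp.linearCombination_apply, Finsupp.sum, mul_add, Finset.sum_add_distrib]
  · intro c a
    refine DFunLike.ext _ _ fun q => ?_
    change Finsupp.linearCombination R (c • a) (s q) = c • Finsupp.linearCombination R a (s q)
    simp [Finsupp.linearCombination_apply, Finsupp.sum, Finset.mul_sum, mul_left_comm]
  -- For fixed `q`, the finite support of `s q` makes the value a finite combination of coordinates
  -- of `a`.
  · refine WeakDual.continuous_of_continuous_eval fun q => ?_
    change Continuous fun a : ℕ → R => Finsupp.linearCombination R a (s q)
    simp only [Finsupp.linearCombination_apply, Finsupp.sum]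
    fun_prop
  · intro φ
    refine DFunLike.ext _ _ fun q => ?_
    change Finsupp.linearCombination R (fun n => φ (r (Finsupp.single n 1))) (s q) = φ q
    have : Finsupp.linearCombination R (fun n => φ (r (Finsupp.single n 1))) =
        φ.toLinearMap ∘ₗ r := by
      ext n
      simp
      rfl
    rw [this]
    exact congrArg φ congr($h q)

theorem isTopRetract_laurent_of_isTateDr {M : TopMod R} (h : isTateDr R M) :
    IsTopRetract R M.obj (laurent R).obj := by
  obtain ⟨N, ⟨P, Q, _, _, _, _, _, _, _, _, hP, hP', hQ, hQ', ⟨e⟩⟩, hMN⟩ := h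
  refine hMN.isTopRetract.trans <| (IsTopRetract.of_equiv
    (e.trans (ContinuousLinearEquiv.prodComm R P (WeakDual R Q)))).trans <|
    ((isTopRetract_weakDual hQ').prod (IsTopRetract.of_equiv (.refl R P))).trans
    (isTopRetract_laurent hP')

end Laurent

/-! ### Limits of Pro-objects and their maps to discrete modules. -/

section ProObjects

variable {R : Type u} [CommRing R]

/-- Surjections of finitely generated projective modules split. -/
theorem exists_section_of_admissibleEpi {A B : ProjFG R} (f : A ⟶ B) (hf : admissibleEpi R f) :
    ∃ s : B ⟶ A, s ≫ f = 𝟙 B := by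
  have := B.property.2
  obtain ⟨s, hs⟩ := Module.projective_lifting_property f.hom.hom LinearMap.id hf
  exact ⟨ObjectProperty.homMk (ModuleCat.ofHom s), by
    ext x
    exact congr($hs x)⟩

variable [TopologicalSpace R] [DiscreteTopology R]

instance (P : ProjFG R) : DiscreteTopology ((discrete R).obj P).obj := ⟨rfl⟩

/-- The actual limit of a formal limit of finitely generated projective modules. -/
noncomputable abbrev proLimit (Y : IndObj (ProjFG R)ᵒᵖ (admissibleEpi R).op) : TopMod R :=
  (colimit (Y.diag ⋙ (discrete R).op)).unop

/-- The projections of the limit. -/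
noncomputable def proπ (Y : IndObj (ProjFG R)ᵒᵖ (admissibleEpi R).op) (i : Y.I) :
    proLimit Y ⟶ (discrete R).obj (Y.diag.obj i).unop :=
  (colimit.ι (Y.diag ⋙ (discrete R).op) i).unop

variable (Y : IndObj (ProjFG R)ᵒᵖ (admissibleEpi R).op)

theorem proπ_map {i j : Y.I} (f : i ⟶ j) :
    proπ Y j ≫ (discrete R).map (Y.diag.map f).unop = proπ Y i :=
  congrArg Quiver.Hom.unop (colimit.w (Y.diag ⋙ (discrete R).op) f)

/-- Sections of surjections onto projectives become retractions in the opposite category, which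
opens the results on split sequences to limits. -/
theorem isSplitMono_stepSeq_pro (n : ℕ) :
    IsSplitMono (Y.stepSeq (discrete R).op n.le_succ) := by
  obtain ⟨s, hs⟩ := exists_section_of_admissibleEpi _
    (Y.admissible (Y.seq.map (homOfLE n.le_succ)))
  refine ⟨⟨((discrete R).map s).op, ?_⟩⟩
  refine Quiver.Hom.unop_inj ?_
  change (discrete R).map s ≫ (discrete R).map (Y.diag.map (Y.seq.map (homOfLE n.le_succ))).unop = _
  rw [← Functor.map_comp, hs]
  exact (discrete R).map_id _

/-- Projections to terms of the cofinal sequence split; any other projection is one of these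
followed by an admissible epic. -/
theorem proπ_surjective (i : Y.I) : Function.Surjective (proπ Y i).hom.hom := by
  obtain ⟨m, -, f, hf⟩ := Y.exists_ι_eq (discrete R).op i 0
  obtain ⟨⟨d, hd⟩⟩ := Y.isSplitMono_ιSeq (discrete R).op (isSplitMono_stepSeq_pro Y) m
  have h₁ : Function.Surjective (proπ Y (Y.seq.obj m)).hom.hom := fun y =>
    ⟨d.unop.hom.hom y, congr(($(congrArg Quiver.Hom.unop hd)).hom.hom y)⟩
  rw [← proπ_map Y f]
  exact (Y.admissible f).comp h₁

/-- The limit carries the topology induced by its projections to discrete modules, and directedness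
reduces finite intersections of kernels to one kernel. -/
theorem proLimit_hasBasis : (nhds (0 : (proLimit Y).obj)).HasBasis (fun _ : Y.I => True)
    (fun i => {x | (proπ Y i).hom.hom x = 0}) := by
  let G := (isLinear R).ι ⋙ forget₂ (TopModuleCat.{u} R) TopCat
  have hl := isLimitConeLeftOpOfCocone _ (colimit.isColimit (Y.diag ⋙ (discrete R).op))
  have hc := isLimitOfPreserves G hl
  have ht : (proLimit Y).obj.topologicalSpace =
      ⨅ j : Y.Iᵒᵖ, ((discrete R).obj (Y.diag.obj j.unop).unop).obj.topologicalSpace.induced (proπ Y j.unop).hom.hom :=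
    TopCat.induced_of_isLimit _ hc
  have hn : nhds (0 : (proLimit Y).obj) =
      ⨅ i : Y.I, Filter.principal {x | (proπ Y i).hom.hom x = 0} := by
    refine (congrArg (fun t => @nhds _ t 0) ht).trans ?_
    rw [nhds_iInf]
    refine Function.Surjective.iInf_congr Opposite.unop Opposite.unop_surjective fun i => ?_
    rw [nhds_induced, map_zero, nhds_discrete ((discrete R).obj (Y.diag.obj i.unop).unop).obj,
      Filter.comap_pure]
    rfl
  rw [hn]
  refine Filter.hasBasis_iInf_principal ?_
  intro i j
  obtain ⟨k, hi, hj⟩ := exists_ge_ge i j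
  refine ⟨k, fun x hx => ?_, fun x hx => ?_⟩
  · change (proπ Y i).hom.hom x = 0
    rw [← proπ_map Y (homOfLE hi)]
    exact (congrArg ((discrete R).map (Y.diag.map (homOfLE hi)).unop).hom.hom hx).trans
      (map_zero ((discrete R).map (Y.diag.map (homOfLE hi)).unop).hom.hom)
  · change (proπ Y j).hom.hom x = 0
    rw [← proπ_map Y (homOfLE hj)]
    exact (congrArg ((discrete R).map (Y.diag.map (homOfLE hj)).unop).hom.hom hx).trans
      (map_zero ((discrete R).map (Y.diag.map (homOfLE hj)).unop).hom.hom)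

theorem realize_injective_pro {U : (ProjFG R)ᵒᵖ} : Function.Injective
    (IndObj.ColimHom.realize (discrete R).op : IndObj.ColimHom U Y → _) := by
  intro x y h
  induction x using IndObj.ColimHom.ind with | h i a
  induction y using IndObj.ColimHom.ind with | h j b
  obtain ⟨k, hi, hj⟩ := exists_ge_ge i j
  refine IndObj.ColimHom.sound (homOfLE hi) (homOfLE hj) (Quiver.Hom.unop_inj ?_)
  have h' : proπ Y i ≫ (discrete R).map a.unop = proπ Y j ≫ (discrete R).map b.unop :=
    congrArg Quiver.Hom.unop h
  rw [← proπ_map Y (homOfLE hi), ← proπ_map Y (homOfLE hj)] at h'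
  ext z
  obtain ⟨x, rfl⟩ := proπ_surjective Y k z
  exact congr(($h').hom.hom x)

/-- A continuous map to a discrete module kills a neighbourhood of `0`, hence the kernel of some
projection, and so descends to that term. -/
theorem realize_surjective_pro {U : (ProjFG R)ᵒᵖ} : Function.Surjective
    (IndObj.ColimHom.realize (discrete R).op : IndObj.ColimHom U Y → _) := by
  intro f
  let g : proLimit Y ⟶ (discrete R).obj U.unop := f.unop
  have hg : ∀ᶠ x in nhds (0 : (proLimit Y).obj), g.hom.hom x = 0 := by
    have := g.hom.hom.continuous.tendsto 0
    rw [map_zero, nhds_discrete ((discrete R).obj U.unop).obj] at this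
    exact Filter.tendsto_pure.1 this
  obtain ⟨i, -, hi⟩ := (proLimit_hasBasis Y).mem_iff.1 hg
  let p := (proπ Y i).hom.hom.toLinearMap
  have hp : Function.Surjective p := proπ_surjective Y i
  have hpg : LinearMap.ker p ≤ LinearMap.ker g.hom.hom.toLinearMap := fun x hx => hi hx
  let a : (Y.diag.obj i).unop ⟶ U.unop := ObjectProperty.homMk (ModuleCat.ofHom
    ((LinearMap.ker p).liftQ _ hpg ∘ₗ (p.quotKerEquivOfSurjective hp).symm.toLinearMap))
  refine ⟨IndObj.ColimHom.mk i a.op, Quiver.Hom.unop_inj ?_⟩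
  change proπ Y i ≫ (discrete R).map a = g
  ext x
  change (LinearMap.ker p).liftQ _ hpg ((p.quotKerEquivOfSurjective hp).symm (p x)) = _
  have : (p.quotKerEquivOfSurjective hp).symm (p x) = Submodule.Quotient.mk x := by
    rw [LinearEquiv.symm_apply_eq]
    rfl
  rw [this]
  rfl

instance : (IndObj.realize (discrete R).op :
    IndObj (ProjFG R)ᵒᵖ (admissibleEpi R).op ⥤ _).Full :=
  IndObj.realize_full _ (fun _ Y _ => realize_surjective_pro Y) fun _ Y _ => realize_injective_pro Y

instance : (IndObj.realize (discrete R).op :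
    IndObj (ProjFG R)ᵒᵖ (admissibleEpi R).op ⥤ _).Faithful :=
  IndObj.realize_faithful _ fun _ Y _ => realize_injective_pro Y

instance : (ProObj.realize (discrete R) : ProFG R ⥤ TopMod R).Full := inferInstance

instance : (ProObj.realize (discrete R) : ProFG R ⥤ TopMod R).Faithful := inferInstance

end ProObjects
-- Splitting of elementary monics.
section ElementaryMono

variable {R : Type u} [CommRing R] [TopologicalSpace R] [DiscreteTopology R]

instance : (discrete R).Full where
  map_surjective f :=
    ⟨ObjectProperty.homMk (ModuleCat.ofHom f.hom.hom.toLinearMap), rfl⟩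

variable (R) in
/-- The realization of Pro-objects. -/
noncomputable abbrev proRealize : ProFG R ⥤ TopMod R := ProObj.realize (discrete R)

/-- The projections of the realization of a Pro-object. -/
noncomputable def proj (B : ProFG R) (i : B.unop.I) :
    (proRealize R).obj B ⟶ (discrete R).obj (B.unop.diag.obj i).unop :=
  proπ B.unop i

theorem proj_map (B : ProFG R) {i j : B.unop.I} (f : i ⟶ j) :
    proj B j ≫ (discrete R).map (B.unop.diag.map f).unop = proj B i :=
  proπ_map B.unop f

theorem map_proj {A B : ProFG R} (f : A ⟶ B) (j : B.unop.I) :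
    (proRealize R).map f ≫ proj B j =
      (IndObj.ColimHom.realize (discrete R).op (f.unop.val j)).unop :=
  Quiver.Hom.op_inj (colimit.ι_desc (F := B.unop.diag ⋙ (discrete R).op)
    { pt := colimit (A.unop.diag ⋙ (discrete R).op), ι := _ } j)

theorem proj_hom_ext {B : ProFG R} {Z : TopMod R} {f g : Z ⟶ (proRealize R).obj B}
    (h : ∀ n, f ≫ proj B (B.unop.seq.obj n) = g ≫ proj B (B.unop.seq.obj n)) : f = g :=
  Quiver.Hom.op_inj (IndObj.seq_hom_ext (F := (discrete R).op) fun n =>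
    congrArg Quiver.Hom.op (h n))

theorem exists_lift {B : ProFG R} {Z : TopMod R}
    (b : ∀ n, Z ⟶ (discrete R).obj (B.unop.diag.obj (B.unop.seq.obj n)).unop)
    (hb : ∀ n, b (n + 1) ≫
      (discrete R).map (B.unop.diag.map (B.unop.seq.map (homOfLE n.le_succ))).unop = b n) :
    ∃ s : Z ⟶ (proRealize R).obj B, ∀ n, s ≫ proj B (B.unop.seq.obj n) = b n := by
  obtain ⟨s, hs⟩ := B.unop.exists_desc (discrete R).op (fun n => (b n).op)
    fun n => congrArg Quiver.Hom.op (hb n)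
  exact ⟨s.unop, fun n => congrArg Quiver.Hom.unop (hs n)⟩

/-- The realization of a Pro-object splits off `Z` if its projections factor through `Z`. -/
theorem exists_retraction {A : ProFG R} {Z : TopMod R} (f : (proRealize R).obj A ⟶ Z)
    (b : ∀ n, Z ⟶ (discrete R).obj (A.unop.diag.obj (A.unop.seq.obj n)).unop)
    (hb : ∀ n, f ≫ b n = proj A (A.unop.seq.obj n)) :
    ∃ r : Z ⟶ (proRealize R).obj A, f ≫ r = 𝟙 _ := by
  obtain ⟨r, hr⟩ := A.unop.exists_section_of_isSplitMono (discrete R).op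
    (isSplitMono_stepSeq_pro A.unop) f.op (fun n => (b n).op)
    fun n => congrArg Quiver.Hom.op (hb n)
  exact ⟨r.unop, congrArg Quiver.Hom.unop hr⟩

/-- The realization of the constant Pro-object `U` maps to `U`. -/
noncomputable def constπ (U : ProjFG R) :
    (proRealize R).obj ((ProObj.const (admissibleEpi R)).obj U) ⟶ (discrete R).obj U :=
  proj ((ProObj.const (admissibleEpi R)).obj U) PUnit.unit

instance (U : ProjFG R) : Mono (constπ U) where
  right_cancellation _ _ h := proj_hom_ext fun _ => h

theorem map_const_comp_constπ {U V : ProjFG R} (k : U ⟶ V) :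
    (proRealize R).map ((ProObj.const (admissibleEpi R)).map k) ≫ constπ V =
      constπ U ≫ (discrete R).map k :=
  map_proj _ _

/-- Turns the conditions in `elementaryMono`, stated for constant Pro-objects, into conditions on
continuous maps to discrete modules. -/
theorem exists_map_comp_constπ {B : ProFG R} {U : ProjFG R}
    (h : (proRealize R).obj B ⟶ (discrete R).obj U) :
    ∃ h' : B ⟶ (ProObj.const (admissibleEpi R)).obj U,
      (proRealize R).map h' ≫ constπ U = h := by
  obtain ⟨x, hx⟩ := realize_surjective_pro B.unop (U := Opposite.op U) h.op
  let h' : ((ProObj.const (admissibleEpi R)).obj U).unop ⟶ B.unop :=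
    IndObj.Hom.mk (fun _ => x) fun _ => IndObj.ColimHom.precomp_id x
  exact ⟨h'.op, (map_proj h'.op PUnit.unit).trans (congrArg Quiver.Hom.unop hx)⟩

theorem proRealize_map_zero (A B : ProFG R) : (proRealize R).map (0 : A ⟶ B) = 0 := by
  refine proj_hom_ext fun n => ?_
  rw [map_proj, zero_comp]
  change proj A (Classical.arbitrary A.unop.I) ≫ (discrete R).map 0 = 0
  exact comp_zero

/-- The realization of an admissible monic whose cokernel is a finitely generated projective
module splits. -/
theorem elementaryMono_split {A B : ProFG R} {f : A ⟶ B} (hf : elementaryMono R f) :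
    ∃ (P : ProjFG R)
      (g : (proRealize R).obj B ⟶ (discrete R).obj P)
      (r : (proRealize R).obj B ⟶ (proRealize R).obj A)
      (s : (discrete R).obj P ⟶ (proRealize R).obj B),
      (proRealize R).map f ≫ r = 𝟙 _ ∧
      (proRealize R).map f ≫ g = 0 ∧
      r ≫ (proRealize R).map f + g ≫ s = 𝟙 _ := by
  obtain ⟨P, g, hfg, hP⟩ := hf
  let τ := proRealize R
  let G := τ.map g ≫ constπ P
  have hfG : τ.map f ≫ G = 0 := by
    rw [← Category.assoc, ← Functor.map_comp, hfg, proRealize_map_zero, zero_comp]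
  have hG (U : ProjFG R) (k : P ⟶ U) : G ≫ (discrete R).map k =
      τ.map (g ≫ (ProObj.const (admissibleEpi R)).map k) ≫ constπ U := by
    rw [Functor.map_comp, Category.assoc, Category.assoc, map_const_comp_constπ]
  -- Translation of `elementaryMono`: by `hker` and `huniq`, `G` acts as a cokernel of `f` when
  -- tested on each `U`; by `hext`, maps to `U` extend along `f`.
  have hker (U : ProjFG R) (h : τ.obj B ⟶ (discrete R).obj U) (hh : τ.map f ≫ h = 0) :
      ∃ k : P ⟶ U, G ≫ (discrete R).map k = h := by
    obtain ⟨h, rfl⟩ := exists_map_comp_constπ h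
    obtain ⟨k, hk, -⟩ := (hP U).1 h <| by
      apply τ.map_injective
      rw [proRealize_map_zero, ← cancel_mono (constπ U), zero_comp, Functor.map_comp,
        Category.assoc]
      exact hh
    exact ⟨k, by rw [hG, hk]⟩
  have huniq (U : ProjFG R) (k k' : P ⟶ U)
      (hk : G ≫ (discrete R).map k = G ≫ (discrete R).map k') : k = k' := by
    rw [hG, hG, cancel_mono] at hk
    have hk := τ.map_injective hk
    obtain ⟨l, -, hl⟩ := (hP U).1 (g ≫ (ProObj.const (admissibleEpi R)).map k) (by
      rw [← Category.assoc, hfg, zero_comp])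
    exact (hl k rfl).trans (hl k' hk.symm).symm
  have hext (U : ProjFG R) (a : τ.obj A ⟶ (discrete R).obj U) :
      ∃ h : τ.obj B ⟶ (discrete R).obj U, τ.map f ≫ h = a := by
    obtain ⟨a, rfl⟩ := exists_map_comp_constπ a
    obtain ⟨h, rfl⟩ := (hP U).2 a
    exact ⟨τ.map h ≫ constπ U, by rw [← Category.assoc, ← Functor.map_comp]⟩
  -- The extended projections of `A` need not be compatible; `exists_retraction` corrects them.
  choose b hb using fun n => hext _ (proj A (A.unop.seq.obj n))
  obtain ⟨r, hr⟩ := exists_retraction (τ.map f) b hb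
  -- The projector complementary to `A` kills `A`, so its components factor through `G`. Uniqueness
  -- makes the factors compatible, and they assemble to `s` with `G ≫ s = e`.
  let e : τ.obj B ⟶ τ.obj B := 𝟙 _ - r ≫ τ.map f
  have he : τ.map f ≫ e = 0 := by
    rw [Preadditive.comp_sub, ← Category.assoc, hr, Category.id_comp, Category.comp_id, sub_self]
  choose k hk using fun n => hker _ (e ≫ proj B (B.unop.seq.obj n)) (by
    rw [← Category.assoc, he, zero_comp])
  obtain ⟨s, hs⟩ := exists_lift (fun n => (discrete R).map (k n)) fun n => by
    rw [← Functor.map_comp]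
    refine congrArg _ (huniq _ _ _ ?_)
    rw [Functor.map_comp, ← Category.assoc, hk, hk, Category.assoc, proj_map]
  have hGs : G ≫ s = e := by
    refine proj_hom_ext fun n => ?_
    rw [Category.assoc, hs, hk]
  refine ⟨P, G, r, s, hr, hfG, ?_⟩
  rw [hGs]
  exact add_sub_cancel _ _

end ElementaryMono

/-! ### Limits of Pro-objects as retracts of `R^ℕ`. -/

section ProRetract

variable {R : Type u} [CommRing R] [TopologicalSpace R] [DiscreteTopology R]

theorem isTopRetract_of_finite {P : Type*} [AddCommGroup P] [Module R P] [TopologicalSpace P]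
    [DiscreteTopology P] [Module.Finite R P] [Module.Projective R P] :
    IsTopRetract R P (ℕ → R) := by
  obtain ⟨n, f, hf⟩ := Module.Finite.exists_fin' R P
  obtain ⟨s, hs⟩ := Module.projective_lifting_property f (LinearMap.id (R := R) (M := P)) hf
  have : IsTopRetract R P (Fin n → R) :=
    ⟨⟨s, continuous_of_discreteTopology⟩, ⟨f, continuous_of_discreteTopology⟩,
      fun x => congr($hs x)⟩
  exact this.trans (isTopRetract_pi Fin.val Fin.val_injective)

theorem isTopRetract_pi_laurent (R : Type u) [CommRing R] [TopologicalSpace R]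
    [DiscreteTopology R] : IsTopRetract R (ℕ → R) (laurent R).obj := by
  have h : CountablyGenerated R PUnit.{u + 1} :=
    ⟨∅, Set.countable_empty, Subsingleton.elim _ _⟩
  refine IsTopRetract.trans ?_ (isTopRetract_laurent h)
  exact ⟨ContinuousLinearMap.inl R _ _, ContinuousLinearMap.fst R _ _, fun _ => rfl⟩

/-- `R ^ ℕ` as a linearly topologized module. -/
noncomputable def piObj (R : Type u) [CommRing R] [TopologicalSpace R]
    [DiscreteTopology R] : TopMod R :=
  -- Double indexing leaves one row `R^ℕ` for each term of a Pro-object.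
  ⟨TopModuleCat.of R (ℕ × ℕ → R), by
    obtain ⟨s, r, h⟩ := isTopRetract_prod_pi.trans (isTopRetract_pi_laurent R)
    exact isLinear_of_isInducing (laurent R) s (IsTopRetract.isEmbedding h).isInducing⟩

/-- Countable limits of surjections of finitely generated projective modules are topological
retracts of `R ^ ℕ`. -/
theorem isTopRetract_proRealize (A : ProFG R) :
    IsTopRetract R ((proRealize R).obj A).obj (ℕ → R) := by
  have h (n : ℕ) : IsTopRetract R
      ((discrete R).obj (A.unop.diag.obj (A.unop.seq.obj n)).unop).obj (ℕ → R) := by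
    have hn := (A.unop.diag.obj (A.unop.seq.obj n)).unop.property
    have : Module.Finite R ((discrete R).obj (A.unop.diag.obj (A.unop.seq.obj n)).unop).obj :=
      hn.1
    have : Module.Projective R ((discrete R).obj (A.unop.diag.obj (A.unop.seq.obj n)).unop).obj :=
      hn.2
    exact isTopRetract_of_finite
  choose s r hsr using h
  -- Row `n` of `S` is the `n`-th projection embedded in `R^ℕ`; `b n` recovers that projection from
  -- row `n`.
  let S : (proRealize R).obj A ⟶ piObj R := ObjectProperty.homMk (ConcreteCategory.ofHom
    (C := TopModuleCat R) (X := ((proRealize R).obj A).obj) (Y := (piObj R).obj)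
    (ContinuousLinearMap.pi fun n : ℕ × ℕ => ContinuousLinearMap.proj (R := R) n.2 ∘L
      s n.1 ∘L (proj A (A.unop.seq.obj n.1)).hom.hom))
  let b (n : ℕ) : piObj R ⟶ (discrete R).obj (A.unop.diag.obj (A.unop.seq.obj n)).unop :=
    ObjectProperty.homMk (ConcreteCategory.ofHom
      (C := TopModuleCat R) (X := (piObj R).obj)
      (Y := ((discrete R).obj (A.unop.diag.obj (A.unop.seq.obj n)).unop).obj)
      (r n ∘L (ContinuousLinearMap.pi fun m => ContinuousLinearMap.proj (R := R) (n, m))))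
  obtain ⟨d, hd⟩ := exists_retraction S b fun n => by
    ext x
    exact hsr n ((proj A (A.unop.seq.obj n)).hom.hom x)
  refine IsTopRetract.trans ?_ isTopRetract_prod_pi
  exact ⟨S.hom.hom, d.hom.hom, fun x => congr(($hd).hom.hom x)⟩

end ProRetract
-- Open submodules and elements of colimits.
section Colimits

variable {R : Type u} [CommRing R] [TopologicalSpace R] [DiscreteTopology R]

/-- Transport to the explicit colimit `colimCocone`, whose basic open submodules are by construction
those tested on terms. -/
theorem isOpen_of_isOpen_comap_ι {J : Type} [SmallCategory J] (F : J ⥤ TopMod R)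
    (N : Submodule R (colimit F).obj)
    (hN : ∀ j, IsOpen ((N.comap (colimit.ι F j).hom.hom.toLinearMap : Submodule R (F.obj j).obj) :
      Set (F.obj j).obj)) :
    IsOpen (N : Set (colimit F).obj) := by
  have : HasColimitsOfSize.{0, 0} (ModuleCat.{u} R) :=
    hasColimitsOfSizeShrink.{0, 0, u, u} (ModuleCat.{u} R)
  let hc := colimIsColimit F (colimit.isColimit (moduleDiagram F))
  let e := (colimit.isColimit F).coconePointUniqueUpToIso hc
  let N' : ColimOpen F (colimit.cocone (moduleDiagram F)) :=
    ⟨N.comap e.inv.hom.hom.toLinearMap, fun j => by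
      convert hN j using 1
      ext x
      have h : (colimCocone F (colimit.cocone (moduleDiagram F))).ι.app j ≫ e.inv =
          colimit.ι F j :=
        (colimit.isColimit F).comp_coconePointUniqueUpToIso_inv hc j
      have hx := congr(($h).hom.hom x)
      change e.inv.hom.hom _ ∈ N ↔ (colimit.ι F j).hom.hom x ∈ N
      rw [← hx]
      rfl⟩
  have h₁ := (ofBasis_hasBasis _ (fun N : ColimOpen F (colimit.cocone (moduleDiagram F)) => N.1)
    (fun N N' => ⟨⟨N.1 ⊓ N'.1, fun j => (N.2 j).inter (N'.2 j)⟩, le_rfl⟩)).mem_of_mem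
    (i := N') trivial
  have h₂ := e.hom.hom.hom.continuous.tendsto 0
  rw [map_zero] at h₂
  refine AddSubgroup.isOpen_of_mem_nhds N.toAddSubgroup (g := 0) ?_
  refine Filter.mem_of_superset (h₂ h₁) fun x hx => ?_
  have hx' : e.inv.hom.hom (e.hom.hom.hom x) ∈ N := hx
  have : e.inv.hom.hom (e.hom.hom.hom x) = x := congr(($e.hom_inv_id).hom.hom x)
  rwa [this] at hx'

/-- Every element of a directed colimit comes from some term. -/
theorem exists_ι_eq_of_directed {J : Type} [PartialOrder J] [IsDirectedOrder J] [Nonempty J]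
    (F : J ⥤ TopMod R) (x : (colimit F).obj) :
    ∃ (j : J) (y : (F.obj j).obj), (colimit.ι F j).hom.hom y = x := by
  let S : Submodule R (colimit F).obj := ⨆ j, LinearMap.range (colimit.ι F j).hom.hom.toLinearMap
  have hS (j : J) (y : (F.obj j).obj) : (colimit.ι F j).hom.hom y ∈ S :=
    Submodule.mem_iSup_of_mem j ⟨y, rfl⟩
  have hop : IsOpen (S : Set (colimit F).obj) := isOpen_of_isOpen_comap_ι F S fun j => by
    convert isOpen_univ
    exact Set.eq_univ_of_forall (hS j)
  -- As `S` is open, the quotient map to a discrete module is continuous. It vanishes on every term,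
  -- hence is zero by the universal property, and `S` is everything.
  let q : colimit F ⟶ discreteObj R ((colimit F).obj ⧸ S) := ObjectProperty.homMk
    (ConcreteCategory.ofHom (C := TopModuleCat R) (X := (colimit F).obj)
      (Y := (discreteObj R ((colimit F).obj ⧸ S)).obj)
      { toLinearMap := S.mkQ
        cont := by
          have : DiscreteTopology (discreteObj R ((colimit F).obj ⧸ S)).obj := ⟨rfl⟩
          refine continuous_of_eventually_eq_zero (R := R)
            (N := (discreteObj R ((colimit F).obj ⧸ S)).obj) S.mkQ ?_
          exact Filter.mem_of_superset (hop.mem_nhds S.zero_mem)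
            fun x hx => (Submodule.Quotient.mk_eq_zero S).2 hx })
  have hq : q = 0 := colimit.hom_ext fun j => by
    ext y
    exact (Submodule.Quotient.mk_eq_zero S).2 (hS j y)
  have hx : x ∈ S := (Submodule.Quotient.mk_eq_zero S).1 congr(($hq).hom.hom x)
  rw [Submodule.mem_iSup_of_directed] at hx
  · exact hx
  · intro i j
    obtain ⟨k, hi, hj⟩ := exists_ge_ge i j
    refine ⟨k, ?_, ?_⟩
    · rintro _ ⟨y, rfl⟩
      exact ⟨(F.map (homOfLE hi)).hom.hom y, congr(($(colimit.w F (homOfLE hi))).hom.hom y)⟩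
    · rintro _ ⟨y, rfl⟩
      exact ⟨(F.map (homOfLE hj)).hom.hom y, congr(($(colimit.w F (homOfLE hj))).hom.hom y)⟩

end Colimits

/-! ### Elementary Tate objects: full faithfulness and retracts. -/

section ElementaryTate

variable {R : Type u} [CommRing R] [TopologicalSpace R] [DiscreteTopology R] (X : TateEl R)

theorem isSplitMono_stepSeq_tate {m n : ℕ} (h : m ≤ n) :
    IsSplitMono (X.stepSeq (proRealize R) h) := by
  obtain ⟨P, g, r, s, hr, -, -⟩ := elementaryMono_split (X.admissible (X.seq.map (homOfLE h)))
  exact ⟨⟨r, hr⟩⟩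

instance (n : ℕ) : IsSplitMono (X.ιSeq (proRealize R) n) :=
  X.isSplitMono_ιSeq _ (fun _ => isSplitMono_stepSeq_tate X _) n

theorem ιSeq_injective (n : ℕ) : Function.Injective (X.ιSeq (proRealize R) n).hom.hom :=
  Function.LeftInverse.injective (g := (retraction (X.ιSeq (proRealize R) n)).hom.hom) fun x =>
    congr(($(IsSplitMono.id (X.ιSeq (proRealize R) n))).hom.hom x)

theorem exists_ιSeq_eq (n : ℕ) (x : (colimit (X.diag ⋙ proRealize R)).obj) :
    ∃ (m : ℕ) (_ : n ≤ m) (y : ((proRealize R).obj (X.diag.obj (X.seq.obj m))).obj),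
      (X.ιSeq (proRealize R) m).hom.hom y = x := by
  obtain ⟨i, y, rfl⟩ := exists_ι_eq_of_directed _ x
  obtain ⟨m, hm, f, hf⟩ := X.exists_ι_eq (proRealize R) i n
  exact ⟨m, hm, ((proRealize R).map (X.diag.map f)).hom.hom y, congr(($hf).hom.hom y)⟩

/-- The terms of a countable elementary Tate object have open image in its realization. -/
theorem isOpen_range_ιSeq (n : ℕ) : IsOpen (LinearMap.range
    (X.ιSeq (proRealize R) n).hom.hom.toLinearMap :
      Set (colimit (X.diag ⋙ proRealize R)).obj) := by
  refine isOpen_of_isOpen_comap_ι (X.diag ⋙ proRealize R) _ fun i => ?_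
  obtain ⟨m, hm, f, hf⟩ := X.exists_ι_eq (proRealize R) i n
  obtain ⟨P, g, r, s, hr, hg, hs⟩ :=
    elementaryMono_split (X.admissible (X.seq.map (homOfLE hm)))
  -- Inside the common later term `m`, the image of term `n` is the kernel of `g`, which is open
  -- because `P` is discrete.
  have hop : IsOpen {y | (((proRealize R).map (X.diag.map f)) ≫ g).hom.hom y = 0} :=
    (isOpen_discrete (α := ((discrete R).obj P).obj) {0}).preimage
      (((proRealize R).map (X.diag.map f)) ≫ g).hom.hom.continuous
  refine (congrArg (@IsOpen ((proRealize R).obj (X.diag.obj i)).obj _)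
    (Set.ext fun y => ?_)).mpr hop
  constructor
  · rintro ⟨z, hz⟩
    have hz' : (X.stepSeq (proRealize R) hm).hom.hom z =
        ((proRealize R).map (X.diag.map f)).hom.hom y := by
      refine ιSeq_injective X m ?_
      exact congr(($(X.stepSeq_ιSeq (proRealize R) hm)).hom.hom z).trans
        (hz.trans congr(($hf).hom.hom y).symm)
    exact (congrArg g.hom.hom hz').symm.trans congr(($hg).hom.hom z)
  · intro hy
    let w := ((proRealize R).map (X.diag.map f)).hom.hom y
    have hy' : g.hom.hom w = 0 := hy
    have hw : (X.stepSeq (proRealize R) hm).hom.hom (r.hom.hom w) + s.hom.hom (g.hom.hom w) = w :=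
      congr(($hs).hom.hom w)
    rw [hy', map_zero, add_zero] at hw
    refine ⟨r.hom.hom w, ?_⟩
    refine congr(($(X.stepSeq_ιSeq (proRealize R) hm)).hom.hom (r.hom.hom w)).symm.trans ?_
    exact (congrArg (X.ιSeq (proRealize R) m).hom.hom hw).trans congr(($hf).hom.hom y)

/-- Terms of the cofinal sequence inject into the colimit, so maps that agree there already agree at
a finite stage. -/
theorem realize_injective_tate {A : ProFG R} : Function.Injective
    (IndObj.ColimHom.realize (proRealize R) : IndObj.ColimHom A X → _) := by
  intro x y h
  induction x using IndObj.ColimHom.ind with | h i a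
  induction y using IndObj.ColimHom.ind with | h j b
  obtain ⟨k, hi, hj⟩ := exists_ge_ge i j
  obtain ⟨m, -, f, hf⟩ := X.exists_ι_eq (proRealize R) k 0
  refine IndObj.ColimHom.sound (homOfLE hi ≫ f) (homOfLE hj ≫ f)
    ((proRealize R).map_injective ?_)
  rw [← cancel_mono (X.ιSeq (proRealize R) m), Functor.map_comp (proRealize R) a,
    Functor.map_comp (proRealize R) b, Category.assoc, Category.assoc]
  have hi := colimit.w (X.diag ⋙ proRealize R) (homOfLE hi ≫ f)
  have hj := colimit.w (X.diag ⋙ proRealize R) (homOfLE hj ≫ f)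
  exact (congrArg (_ ≫ ·) hi).trans (h.trans (congrArg (_ ≫ ·) hj).symm)

theorem realize_surjective_tate {A : ProFG R} : Function.Surjective
    (IndObj.ColimHom.realize (proRealize R) : IndObj.ColimHom A X → _) := by
  intro h
  let ι (n : ℕ) := X.ιSeq (proRealize R) n
  have hmono : ∀ m n, m ≤ n → ∀ z, z ∈ Set.range (ι m).hom.hom → z ∈ Set.range (ι n).hom.hom := by
    rintro m n hmn _ ⟨y, rfl⟩
    exact ⟨(X.stepSeq (proRealize R) hmn).hom.hom y,
      congr(($(X.stepSeq_ιSeq (proRealize R) hmn)).hom.hom y)⟩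
  have h0 : ∀ᶠ x in nhds (0 : ((proRealize R).obj A).obj),
      h.hom.hom x ∈ Set.range (ι 0).hom.hom := by
    have := h.hom.hom.continuous.tendsto 0
    rw [map_zero] at this
    exact this ((isOpen_range_ιSeq X 0).mem_nhds (Submodule.zero_mem _))
  obtain ⟨i, -, hi⟩ := (proLimit_hasBasis A.unop).mem_iff.1 h0
  have key : ∀ y : ((discrete R).obj (A.unop.diag.obj i).unop).obj, ∃ (n : ℕ) (x : _),
      (proj A i).hom.hom x = y ∧ h.hom.hom x ∈ Set.range (ι n).hom.hom := by
    intro y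
    obtain ⟨x, hx⟩ := proπ_surjective A.unop i y
    obtain ⟨n, -, z, hz⟩ := exists_ιSeq_eq X 0 (h.hom.hom x)
    exact ⟨n, x, hx, z, hz⟩
  choose n x hx hxn using key
  -- Finitely many lifts of generators of the term `i` reach a common stage `N`, and the kernel of
  -- `proj A i` already lands in stage `0`; together they span.
  obtain ⟨S, hS⟩ := (A.unop.diag.obj i).unop.property.1.fg_top
  let N := S.sup n
  let K : Submodule R ((proRealize R).obj A).obj :=
    (LinearMap.range (ι N).hom.hom.toLinearMap).comap h.hom.hom.toLinearMap
  have hK : K.map (proj A i).hom.hom.toLinearMap = ⊤ := by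
    refine eq_top_iff.2 (hS.symm.le.trans (Submodule.span_le.2 fun y hy => ?_))
    exact ⟨x y, hmono _ _ (Finset.le_sup hy) _ (hxn y), hx y⟩
  have hrange (z) : h.hom.hom z ∈ Set.range (ι N).hom.hom := by
    obtain ⟨w, hw, hwz⟩ : (proj A i).hom.hom z ∈ K.map (proj A i).hom.hom.toLinearMap := by
      rw [hK]
      trivial
    have hker : (proj A i).hom.hom (z - w) = 0 := by
      rw [map_sub, sub_eq_zero]
      exact hwz.symm
    have h₁ : z - w ∈ K := hmono _ _ N.zero_le _ (hi hker)
    have := K.add_mem h₁ hw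
    rwa [sub_add_cancel] at this
  obtain ⟨f, hf⟩ := (proRealize R).map_surjective (h ≫ retraction (ι N))
  refine ⟨IndObj.ColimHom.mk _ f, ?_⟩
  change (proRealize R).map f ≫ ι N = h
  rw [hf]
  ext z
  obtain ⟨y, hy⟩ := hrange z
  change (ι N).hom.hom ((retraction (ι N)).hom.hom (h.hom.hom z)) = h.hom.hom z
  rw [← hy]
  exact congrArg (ι N).hom.hom congr(($(IsSplitMono.id (ι N))).hom.hom y)

instance : (realizationEl R).Full :=
  IndObj.realize_full _ (fun _ Y _ => realize_surjective_tate Y) fun _ Y _ =>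
    realize_injective_tate Y

instance : (realizationEl R).Faithful :=
  IndObj.realize_faithful _ fun _ Y _ => realize_injective_tate Y

/-- Realizations of countable elementary Tate objects are topological retracts of `R((t))`. -/
theorem isTopRetract_realizationEl : IsTopRetract R ((realizationEl R).obj X).obj
    (laurent R).obj := by
  -- Term `n` is term `0` plus a finitely generated projective complement; `p` and `q` route the
  -- projector to that complement through `R^(ℕ)`.
  have hsplit (n : ℕ) : ∃ (b : (proRealize R).obj (X.diag.obj (X.seq.obj n)) ⟶
        (proRealize R).obj (X.diag.obj (X.seq.obj 0)))
      (p : (proRealize R).obj (X.diag.obj (X.seq.obj n)) ⟶ discreteObj R (ℕ →₀ R))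
      (q : discreteObj R (ℕ →₀ R) ⟶ (proRealize R).obj (X.diag.obj (X.seq.obj n))),
      b ≫ X.stepSeq (proRealize R) n.zero_le + p ≫ q = 𝟙 _ := by
    obtain ⟨P, g, r, s, -, -, hs⟩ :=
      elementaryMono_split (X.admissible (X.seq.map (homOfLE n.zero_le)))
    have := P.property.1
    have := P.property.2
    obtain ⟨σ, ρ, hσ⟩ := exists_section_of_countablyGenerated (countablyGenerated_of_finite (R := R) P.obj)
    let σ' : (discrete R).obj P ⟶ discreteObj R (ℕ →₀ R) :=
      ObjectProperty.homMk (ConcreteCategory.ofHom (C := TopModuleCat R)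
        (X := ((discrete R).obj P).obj) (Y := (discreteObj R (ℕ →₀ R)).obj) ⟨σ, continuous_bot⟩)
    let ρ' : discreteObj R (ℕ →₀ R) ⟶ (discrete R).obj P :=
      ObjectProperty.homMk (ConcreteCategory.ofHom (C := TopModuleCat R)
        (X := (discreteObj R (ℕ →₀ R)).obj) (Y := ((discrete R).obj P).obj) ⟨ρ, continuous_bot⟩)
    have hσ' : σ' ≫ ρ' = 𝟙 _ := by
      ext x
      exact congr($hσ x)
    refine ⟨r, g ≫ σ', ρ' ≫ s, ?_⟩
    rw [Category.assoc, ← Category.assoc σ', hσ', Category.id_comp]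
    exact hs
  choose b p q hbpq using hsplit
  let X₀ := (proRealize R).obj (X.diag.obj (X.seq.obj 0))
  let D := discreteObj R (ℕ × ℕ →₀ R)
  have : DiscreteTopology D.obj := ⟨rfl⟩
  have : Module.Projective R D.obj := inferInstanceAs (Module.Projective R (ℕ × ℕ →₀ R))
  have hD : CountablyGenerated R D.obj := countablyGenerated_finsupp (R := R) (ℕ × ℕ)
  have hZ : IsTopRetract R (X₀.obj × D.obj) (laurent R).obj :=
    ((isTopRetract_proRealize _).prod (IsTopRetract.of_equiv (.refl R D.obj))).trans
      (isTopRetract_laurent hD)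
  let Z : TopMod R := ⟨TopModuleCat.of R (X₀.obj × D.obj), by
    obtain ⟨s, r, h⟩ := hZ
    exact isLinear_of_isInducing (laurent R) s (IsTopRetract.isEmbedding h).isInducing⟩
  let T := colimit (X.diag ⋙ proRealize R)
  let incl (n : ℕ) : (discreteObj R (ℕ →₀ R)).obj →L[R] D.obj :=
    ⟨Finsupp.lmapDomain R R (fun k => (n, k)), continuous_bot⟩
  -- Each term gets its own row `n` of `R^(ℕ × ℕ)`, so one map `r` can undo all the `B n`. The `B n`
  -- need not be compatible, but their composites with `r` are the maps to the colimit, which is all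
  -- that `exists_section_of_isSplitMono` asks.
  let B (n : ℕ) : (proRealize R).obj (X.diag.obj (X.seq.obj n)) ⟶ Z :=
    ObjectProperty.homMk (ConcreteCategory.ofHom (C := TopModuleCat R)
      (X := ((proRealize R).obj (X.diag.obj (X.seq.obj n))).obj) (Y := Z.obj)
      ((b n).hom.hom.prod (incl n ∘L (p n).hom.hom)))
  let c (nk : ℕ × ℕ) : T.obj := (q nk.1 ≫ X.ιSeq (proRealize R) nk.1).hom.hom
    (Finsupp.single nk.2 1 : ℕ →₀ R)
  let C : D.obj →L[R] T.obj := ⟨Finsupp.linearCombination R c, continuous_bot⟩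
  let r : Z ⟶ T := ObjectProperty.homMk (ConcreteCategory.ofHom (C := TopModuleCat R)
    (X := Z.obj) (Y := T.obj) ((X.ιSeq (proRealize R) 0).hom.hom.coprod C))
  have hC (n : ℕ) (v : ℕ →₀ R) : C (incl n v) =
      (q n ≫ X.ιSeq (proRealize R) n).hom.hom v := by
    refine (Finsupp.linearCombination_mapDomain R (fun k => (n, k)) v).trans ?_
    have : Finsupp.linearCombination R (c ∘ fun k => (n, k)) =
        (q n ≫ X.ιSeq (proRealize R) n).hom.hom.toLinearMap := by
      refine Finsupp.lhom_ext' fun k => LinearMap.ext_ring ?_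
      exact (Finsupp.linearCombination_single R 1 k).trans (one_smul R _)
    exact congr($this v)
  obtain ⟨d, hd⟩ := X.exists_section_of_isSplitMono (proRealize R)
    (fun n => isSplitMono_stepSeq_tate X _) r B fun n => by
      rw [← Category.id_comp (X.ιSeq _ n), ← hbpq n, Preadditive.add_comp, Category.assoc,
        X.stepSeq_ιSeq, Category.assoc]
      ext x
      exact congrArg (_ + ·) (hC n ((p n).hom.hom x))
  refine IsTopRetract.trans ?_ hZ
  exact ⟨d.hom.hom, r.hom.hom, fun x => congr(($hd).hom.hom x)⟩

theorem isTopRetract_realization (T : Tate R) :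
    IsTopRetract R ((realization R).obj T).obj (laurent R).obj := by
  obtain ⟨h⟩ := nonempty_retract_functorExtension (realizationEl R) T
  exact (isTopRetract_of_retract h).trans (isTopRetract_realizationEl T.X)

end ElementaryTate

end CountableTate

/-! ### The main theorem. -/

open CountableTate
theorem corollary1p3 (R : Type u) [CommRing R] [TopologicalSpace R] [DiscreteTopology R] :
    -- the realization functor is fully faithful
    (realization R).Full ∧ (realization R).Faithful ∧
    -- it factors through compactly generated weakly Hausdorff modules
    (∃ G : Tate R ⥤ TopModCGWH R, G ⋙ (isCGWH R).ι = realization R) ∧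
    -- its values are metrizable, and direct summands of `R((t))`
    (∀ T : Tate R, IsDirectSummand ((realization R).obj T) (laurent R) ∧
      TopologicalSpace.MetrizableSpace ((realization R).obj T).obj) ∧
    -- the inclusion of topological countable Tate modules into linearly topologized modules
    -- factors through compactly generated weakly Hausdorff modules
    (∃ G : TateDr R ⥤ TopModCGWH R, G ⋙ (isCGWH R).ι = (isTateDr R).ι) ∧
    -- topological countable Tate modules are metrizable, and direct summands of `R((t))`
    (∀ M : TopMod R, isTateDr R M → IsDirectSummand M (laurent R) ∧
      TopologicalSpace.MetrizableSpace M.obj) := by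
  have := laurent_metrizableSpace (R := R)
  have hT (T : Tate R) := (isTopRetract_realization T).metrizableSpace
  have hM (M : TopMod R) (h : isTateDr R M) :=
    (isTopRetract_laurent_of_isTateDr h).metrizableSpace
  exact ⟨functorExtension_full (realizationEl R), functorExtension_faithful (realizationEl R),
    ⟨(isCGWH R).lift (realization R) fun T => isCGWH_of_metrizableSpace _, rfl⟩,
    fun T => ⟨isDirectSummand_of_isTopRetract (isTopRetract_realization T), hT T⟩,
    ⟨(isCGWH R).lift (isTateDr R).ι fun M =>
      have := hM M.obj M.property
      isCGWH_of_metrizableSpace M.obj, rfl⟩,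
    fun M h => ⟨isDirectSummand_of_isTopRetract (isTopRetract_laurent_of_isTateDr h), hM M h⟩⟩
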